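/- Let $\mathrm{St}(n,k)=\{X\in\mathbb{R}^{n\times k}: X^\top X=I_k\}$, regarded as a submanifold of $\mathbb{R}^{n\times k}$ with the Euclidean metric $\langle V,W\rangle=2\,\mathrm{tr}(V^\top W)$, and let $G=O(n)\times O(k)$ act on $\mathbb{R}^{n\times k}$ by $\Phi_{(R,\theta)}(V)=RV\theta^\top$. Let $X\in\mathrm{St}(n,k)$, let $\pi:G\to G/H$ be the projection onto the quotient by the isotropy group $H$ of $X$, and $\iota_X:G/H\to\mathrm{St}(n,k)$, $gH\mapsto\Phi_g(X)$, so that $(\iota_X\circ\pi)(R,\theta)=RX\theta^\top$ and $d_e(\iota_X\circ\pi)(\Omega,\eta)=\Omega X-X\eta$. Let $\mathfrak g=\mathfrak{so}(n)\times\mathfrak{so}(k)$, let $\mathfrak h=\{(\Omega,\eta)\in\mathfrak g:\Omega X=X\eta\}$ be the Lie algebra of $H$, and let $\mathfrak p=\mathfrak h^\perp$ with respect to the scalar product $-\mathrm{tr}(\Omega_1\Omega_2)+2\,\mathrm{tr}(\eta_1\eta_2)$ on $\mathfrak g$. Then $\mathfrak g=\mathfrak h\oplus\mathfrak p$; let $\mathrm{pr}_{\mathfrak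 p}$ be the projection onto $\mathfrak p$ along $\mathfrak h$, and write $\xi=\xi_{\mathfrak h}+\xi_{\mathfrak p}$ for $\xi\in\mathfrak g$. Let $P_X^\perp$ be the orthogonal projection of $\mathbb{R}^{n\times k}$ onto the normal space $N_X\mathrm{St}(n,k)$, and $f_{(\xi_1,\xi_2)}(V)=\xi_1V-V\xi_2$. For submanifolds $M,\widehat M$ of a (pseudo-)Euclidean vector space and an interval $I$, an extrinsic rolling of $M$ over $\widehat M$ is a quadruple $(\beta(t),\widehat\beta(t),B(t),C(t))$, $t\in I$, of smooth curves $\beta$ in $M$ and $\widehat\beta$ in $\widehat M$ and linear isometries $B(t):T_{\beta(t)}M\to T_{\widehat\beta(t)}\widehat M$ and $C(t):N_{\beta(t)}M\to N_{\widehat\beta(t)}\widehat M$ such that (no slip) $\dot{\widehat\beta}(t)=B(t)\dot\beta(t)$; (no twist, tangential part) $B(t)Z(t)$ is parallel along $\widehat\beta$ iff $Z(t)$ is parallel along $\beta$; (no twist, normal part) $C(t)Z(t)$ is normal parallel along $\widehat\beta$ iff $Z(t)$ is normal parallel along $\beta$. Here a tangent (respectively normal) vector field along a curve is parallel (respectively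 normal parallel) if the tangential (respectively normal) part of its derivative vanishes. **Proposition.** Let $X\in\mathrm{St}(n,k)$, $\xi=(\xi_1,\xi_2)\in\mathfrak{so}(n)\times\mathfrak{so}(k)$, and let $I\subseteq\mathbb{R}$ be an interval with more than one point. Put $$\alpha(t)=\int_0^t\exp\!\big(s(\mathrm{ad}_{\xi_{\mathfrak h}}+\tfrac12\,\mathrm{pr}_{\mathfrak p}\circ\mathrm{ad}_{\xi_{\mathfrak p}})\big)(\xi_{\mathfrak p})\,ds,\qquad q(t)=\exp(t\xi)\exp(-t\xi_{\mathfrak h}),$$ $$S(t)=\mathrm{Ad}_{\exp(t\xi_{\mathfrak h})}\circ\exp\!\big(-t(\mathrm{ad}_{\xi_{\mathfrak h}}+\tfrac12\,\mathrm{pr}_{\mathfrak p}\circ\mathrm{ad}_{\xi_{\mathfrak p}})\big),\qquad T(t)=\Phi_{\exp(t\xi_{\mathfrak h})}\circ\exp\!\big(-t\,P_X^\perp\circ f_{(\xi_1,\xi_2)}\big).$$ Then $d_e(\iota_X\circ\pi)$ maps $\mathfrak p$ bijectively onto $T_X\mathrm{St}(n,k)$, $\alpha$ takes values in $\mathfrak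 p$, $S(t)$ restricts to a linear isometry of $\mathfrak p$ onto itself, $T(t)$ restricts to a linear isometry of $N_X\mathrm{St}(n,k)$ onto itself, and the quadruple $(\beta(t),\widehat\beta(t),B(t),C(t))$, $t\in I$, given by $$\beta(t)=d_e(\iota_X\circ\pi)(\alpha(t)),\qquad \widehat\beta(t)=(\iota_X\circ\pi)(\exp(t\xi))=e^{t\xi_1}Xe^{-t\xi_2},$$ $$B(t)=d_{q(t)}(\iota_X\circ\pi)\circ d_eL_{q(t)}\circ S(t)\circ\big(d_e(\iota_X\circ\pi)|_{\mathfrak p}\big)^{-1},\qquad C(t)=\Phi_{q(t)}\circ T(t),$$ is an extrinsic rolling of $T_X\mathrm{St}(n,k)$ over $\mathrm{St}(n,k)$ with respect to the Euclidean metric. Here $L_g$ is left translation by $g\in G$, and $T_{\beta(t)}(T_X\mathrm{St}(n,k))$ and $N_{\beta(t)}(T_X\mathrm{St}(n,k))$ are identified with $T_X\mathrm{St}(n,k)$ and $N_X\mathrm{St}(n,k)$. -/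

import Mathlib

open scoped Matrix ContDiff

/- Spaces of real matrices are normed by the Frobenius norm, i.e. (up to the constant `√2`) by the
norm of the Euclidean metric below. -/
attribute [local instance] Matrix.frobeniusNormedAddCommGroup Matrix.frobeniusNormedSpace

noncomputable section

/-! ### Extrinsic rolling of submanifolds of a pseudo-Euclidean vector space -/

namespace Rolling

variable {V : Type*} [NormedAddCommGroup V] [NormedSpace ℝ V]

/-- The tangent space at `p` of an embedded submanifold `M` of `V`, as a linear subspace of `V`:
the velocities at `p` of the smooth curves in `M` through `p`. -/
def tangentSpace (M : Set V) (p : V) : Submodule ℝ V :=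
  Submodule.span ℝ {v | ∃ γ : ℝ → V, ∃ ε : ℝ, 0 < ε ∧
    ContDiffOn ℝ ∞ γ (Set.Ioo (-ε) ε) ∧ (∀ s ∈ Set.Ioo (-ε) ε, γ s ∈ M) ∧
    γ 0 = p ∧ HasDerivAt γ v 0}

/-- The normal space of `M` at `p` with respect to the scalar product `g` of `V`. -/
def normalSpace (g : LinearMap.BilinForm ℝ V) (M : Set V) (p : V) : Submodule ℝ V :=
  g.orthogonal (tangentSpace M p)

/-- `A` restricts to a linear isometry of the subspace `E` onto the subspace `F`. The values of
`A` outside of `E` are irrelevant. -/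
structure IsLinearIsometryBetween {W W' : Type*} [AddCommGroup W] [Module ℝ W]
    [AddCommGroup W'] [Module ℝ W'] (g : LinearMap.BilinForm ℝ W) (g' : LinearMap.BilinForm ℝ W')
    (E : Submodule ℝ W) (F : Submodule ℝ W') (A : W → W') : Prop where
  map_add : ∀ v ∈ E, ∀ w ∈ E, A (v + w) = A v + A w
  map_smul : ∀ c : ℝ, ∀ v ∈ E, A (c • v) = c • A v
  bijOn : Set.BijOn A E F
  isometry : ∀ v ∈ E, ∀ w ∈ E, g' (A v) (A w) = g v w

/-- `Z` is a parallel (tangent) vector field of `M` along the curve `γ : I → M`. The Levi-Civita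
covariant derivative along `γ` of the metric induced by `g` is the tangential part of the
derivative in `V`; it vanishes iff the derivative in `V` is orthogonal to the tangent space. -/
def IsParallelAlong (g : LinearMap.BilinForm ℝ V) (M : Set V) (I : Set ℝ) (γ Z : ℝ → V) : Prop :=
  ContDiffOn ℝ ∞ Z I ∧ (∀ t ∈ I, Z t ∈ tangentSpace M (γ t)) ∧
    ∀ t ∈ I, ∀ w ∈ tangentSpace M (γ t), g (derivWithin Z I t) w = 0

/-- `Z` is a normal parallel vector field of `M` along the curve `γ : I → M`: it is a normal field
and the normal part of its derivative in `V` vanishes. -/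
def IsNormalParallelAlong (g : LinearMap.BilinForm ℝ V) (M : Set V) (I : Set ℝ) (γ Z : ℝ → V) :
    Prop :=
  ContDiffOn ℝ ∞ Z I ∧ (∀ t ∈ I, Z t ∈ normalSpace g M (γ t)) ∧
    ∀ t ∈ I, ∀ w ∈ normalSpace g M (γ t), g (derivWithin Z I t) w = 0

/-- The quadruple `(α(t), α'(t), A(t), C(t))`, `t ∈ I`, is an extrinsic rolling of `M` over `M'`,
both being submanifolds of the pseudo-Euclidean vector space `(V, g)`. -/
structure IsExtrinsicRolling (g : LinearMap.BilinForm ℝ V) (M M' : Set V) (I : Set ℝ)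
    (α α' : ℝ → V) (A C : ℝ → V → V) : Prop where
  smooth_rolling : ContDiffOn ℝ ∞ α I
  smooth_development : ContDiffOn ℝ ∞ α' I
  rolling_mem : ∀ t ∈ I, α t ∈ M
  development_mem : ∀ t ∈ I, α' t ∈ M'
  tangent_isometry : ∀ t ∈ I,
    IsLinearIsometryBetween g g (tangentSpace M (α t)) (tangentSpace M' (α' t)) (A t)
  normal_isometry : ∀ t ∈ I,
    IsLinearIsometryBetween g g (normalSpace g M (α t)) (normalSpace g M' (α' t)) (C t)
  no_slip : ∀ t ∈ I, derivWithin α' I t = A t (derivWithin α I t)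
  no_twist_tangential : ∀ Z : ℝ → V, (∀ t ∈ I, Z t ∈ tangentSpace M (α t)) →
    (IsParallelAlong g M' I α' (fun t => A t (Z t)) ↔ IsParallelAlong g M I α Z)
  no_twist_normal : ∀ Z : ℝ → V, (∀ t ∈ I, Z t ∈ normalSpace g M (α t)) →
    (IsNormalParallelAlong g M' I α' (fun t => C t (Z t)) ↔ IsNormalParallelAlong g M I α Z)

/-- The exponential of an endomorphism of a finite-dimensional real vector space. -/
def opExp [FiniteDimensional ℝ V] (A : V →ₗ[ℝ] V) : V →ₗ[ℝ] V :=
  (NormedSpace.exp (LinearMap.toContinuousLinearMap A) : V →L[ℝ] V)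

end Rolling

/-! ### The Stiefel manifold and the action of `O(n) × O(k)` -/

namespace Stiefel

open Rolling

variable {n k : ℕ}

/-- The Stiefel manifold `St(n,k)`, as a subset of the real `n × k` matrices. -/
def stiefel (n k : ℕ) : Set (Matrix (Fin n) (Fin k) ℝ) := {X | Xᵀ * X = 1}

/-- The Euclidean metric `⟨V, W⟩ = 2 tr(Vᵀ W)`. -/
def euclideanMetric (n k : ℕ) : LinearMap.BilinForm ℝ (Matrix (Fin n) (Fin k) ℝ) :=
  LinearMap.mk₂ ℝ (fun V W => 2 * (Vᵀ * W).trace)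
    (by intro a b c; simp [Matrix.add_mul]; ring)
    (by intro c a b; simp; ring)
    (by intro a b c; simp [Matrix.mul_add]; ring)
    (by intro c a b; simp; ring)

/-- The Lie group `G = O(n) × O(k)`. -/
abbrev G (n k : ℕ) := Matrix.orthogonalGroup (Fin n) ℝ × Matrix.orthogonalGroup (Fin k) ℝ

/-- The space `𝔰𝔬(n)` of skew-symmetric matrices. -/
def so (n : ℕ) : Submodule ℝ (Matrix (Fin n) (Fin n) ℝ) where
  carrier := {A | Aᵀ = -A}
  add_mem' := by
    intro a b ha hb
    simp only [Set.mem_ofPred_eq] at *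
    rw [Matrix.transpose_add, ha, hb]; abel
  zero_mem' := by simp
  smul_mem' := by
    intro c a ha
    simp only [Set.mem_ofPred_eq] at *
    rw [Matrix.transpose_smul, ha, smul_neg]

/-- The Lie algebra `𝔤 = 𝔰𝔬(n) × 𝔰𝔬(k)` of `G`. -/
abbrev LieG (n k : ℕ) := so n × so k

theorem so_transpose {n : ℕ} (A : so n) : (A : Matrix (Fin n) (Fin n) ℝ)ᵀ = -A := A.2

/-- `ad_ξ = [ξ, ·]` on `𝔰𝔬(n)`, with the commutator of matrices as Lie bracket. -/
def soAd {n : ℕ} (A : so n) : so n →ₗ[ℝ] so n where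
  toFun B := ⟨(A : Matrix (Fin n) (Fin n) ℝ) * B - B * A, by
    change (_ : Matrix (Fin n) (Fin n) ℝ)ᵀ = - _
    rw [Matrix.transpose_sub, Matrix.transpose_mul, Matrix.transpose_mul, so_transpose,
      so_transpose]
    simp⟩
  map_add' := by
    intro x y; ext1
    simp [mul_add, add_mul]; abel
  map_smul' := by
    intro c x; ext1
    simp [smul_sub]

/-- `ad_ξ` on `𝔤 = 𝔰𝔬(n) × 𝔰𝔬(k)`. -/
def ad (ξ : LieG n k) : LieG n k →ₗ[ℝ] LieG n k := (soAd ξ.1).prodMap (soAd ξ.2)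

theorem exp_mem_orthogonalGroup {n : ℕ} (A : so n) :
    NormedSpace.exp (A : Matrix (Fin n) (Fin n) ℝ) ∈ Matrix.orthogonalGroup (Fin n) ℝ := by
  rw [Matrix.mem_orthogonalGroup_iff, ← Matrix.exp_transpose, so_transpose,
    ← Matrix.exp_add_of_commute _ _ (Commute.neg_right (Commute.refl (A : Matrix (Fin n) (Fin n) ℝ))),
    add_neg_cancel, NormedSpace.exp_zero]

/-- The exponential map `𝔤 → G`, `exp(ξ) = (e^{ξ₁}, e^{ξ₂})`. -/
def expG (ξ : LieG n k) : G n k :=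
  (⟨NormedSpace.exp (ξ.1 : Matrix (Fin n) (Fin n) ℝ), exp_mem_orthogonalGroup ξ.1⟩,
   ⟨NormedSpace.exp (ξ.2 : Matrix (Fin k) (Fin k) ℝ), exp_mem_orthogonalGroup ξ.2⟩)

/-- `Ad_R(Ω) = R Ω R⁻¹ = R Ω Rᵀ` on `𝔰𝔬(n)`. -/
def soAdjoint {n : ℕ} (R : Matrix.orthogonalGroup (Fin n) ℝ) : so n →ₗ[ℝ] so n where
  toFun B := ⟨(R : Matrix (Fin n) (Fin n) ℝ) * B * (R : Matrix (Fin n) (Fin n) ℝ)ᵀ, by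
    change (_ : Matrix (Fin n) (Fin n) ℝ)ᵀ = - _
    rw [Matrix.transpose_mul, Matrix.transpose_mul, so_transpose, Matrix.transpose_transpose]
    simp [mul_assoc]⟩
  map_add' := by
    intro x y; ext1
    simp [mul_add, add_mul]
  map_smul' := by
    intro c x; ext1
    simp

/-- The adjoint representation `Ad` of `G` on `𝔤`. -/
def Ad (g : G n k) : LieG n k →ₗ[ℝ] LieG n k := (soAdjoint g.1).prodMap (soAdjoint g.2)

/-- The action `Φ_{(R,θ)}(V) = R V θᵀ` of `G` on the real `n × k` matrices. -/
def Phi (g : G n k) : Matrix (Fin n) (Fin k) ℝ →ₗ[ℝ] Matrix (Fin n) (Fin k) ℝ where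
  toFun V := (g.1 : Matrix (Fin n) (Fin n) ℝ) * V * (g.2 : Matrix (Fin k) (Fin k) ℝ)ᵀ
  map_add' := by intro x y; simp [Matrix.mul_add, Matrix.add_mul]
  map_smul' := by intro c x; simp

/-- The linear map `f_{(ξ₁,ξ₂)}(V) = ξ₁ V - V ξ₂`. -/
def f (ξ : LieG n k) : Matrix (Fin n) (Fin k) ℝ →ₗ[ℝ] Matrix (Fin n) (Fin k) ℝ where
  toFun V := (ξ.1 : Matrix (Fin n) (Fin n) ℝ) * V - V * (ξ.2 : Matrix (Fin k) (Fin k) ℝ)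
  map_add' := by intro x y; simp [Matrix.mul_add, Matrix.add_mul]; abel
  map_smul' := by intro c x; simp [smul_sub]

/-- The differential at `g ∈ G` of `Φ_X = ι_X ∘ π : (R,θ) ↦ R X θᵀ`, as the restriction to
`T_g G` of the differential of the same formula on pairs of arbitrary matrices. -/
def dPhi (X : Matrix (Fin n) (Fin k) ℝ) (g : G n k) :
    Matrix (Fin n) (Fin n) ℝ × Matrix (Fin k) (Fin k) ℝ →L[ℝ] Matrix (Fin n) (Fin k) ℝ :=
  fderiv ℝ (fun h : Matrix (Fin n) (Fin n) ℝ × Matrix (Fin k) (Fin k) ℝ => h.1 * X * h.2ᵀ)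
    ((g.1 : Matrix (Fin n) (Fin n) ℝ), (g.2 : Matrix (Fin k) (Fin k) ℝ))

/-- The differential `d_e L_g : 𝔤 → T_g G` of the left translation by `g`. -/
def dL (g : G n k) (ζ : LieG n k) : Matrix (Fin n) (Fin n) ℝ × Matrix (Fin k) (Fin k) ℝ :=
  ((g.1 : Matrix (Fin n) (Fin n) ℝ) * (ζ.1 : Matrix (Fin n) (Fin n) ℝ),
   (g.2 : Matrix (Fin k) (Fin k) ℝ) * (ζ.2 : Matrix (Fin k) (Fin k) ℝ))

/-! ### The reductive decomposition `𝔤 = 𝔥 ⊕ 𝔭` and the orthogonal projections -/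

/-- The scalar product `-tr(Ω₁ Ω₂) - (1/a) tr(Ψ₁ Ψ₂)` on `𝔤` that induces the `α`-metric with
parameter `α = a`. -/
def alphaForm (n k : ℕ) (a : ℝ) : LinearMap.BilinForm ℝ (LieG n k) :=
  LinearMap.mk₂ ℝ (fun ξ η =>
      - ((ξ.1 : Matrix (Fin n) (Fin n) ℝ) * (η.1 : Matrix (Fin n) (Fin n) ℝ)).trace
      - 1 / a * ((ξ.2 : Matrix (Fin k) (Fin k) ℝ) * (η.2 : Matrix (Fin k) (Fin k) ℝ)).trace)
    (by intro x y z; simp [add_mul]; ring)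
    (by intro c x y; simp; ring)
    (by intro x y z; simp [mul_add]; ring)
    (by intro c x y; simp; ring)

/-- The Lie algebra `𝔥` of the isotropy group of `X`, i.e. the kernel of
`d_e Φ_X : (Ω, η) ↦ Ω X - X η`. -/
def hSpace (X : Matrix (Fin n) (Fin k) ℝ) : Submodule ℝ (LieG n k) where
  carrier := {ξ | f ξ X = 0}
  add_mem' := by
    intro a b ha hb
    have : f (a + b) X = f a X + f b X := by
      simp [f, Matrix.mul_add, Matrix.add_mul]; abel
    simp only [Set.mem_ofPred_eq] at *
    rw [this, ha, hb, add_zero]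
  zero_mem' := by simp [f]
  smul_mem' := by
    intro c a ha
    have : f (c • a) X = c • f a X := by simp [f, smul_sub]
    simp only [Set.mem_ofPred_eq] at *
    rw [this, ha, smul_zero]

/-- The orthogonal complement `𝔭 = 𝔥^⊥` with respect to the scalar product for `α = -1/2`. -/
def pSpace (X : Matrix (Fin n) (Fin k) ℝ) : Submodule ℝ (LieG n k) :=
  (alphaForm n k (-1 / 2)).orthogonal (hSpace X)

theorem trace_transpose_mul_self_eq_zero {m l : ℕ} (A : Matrix (Fin m) (Fin l) ℝ)
    (h : (Aᵀ * A).trace = 0) : A = 0 := by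
  have h' : (Aᴴ * A).trace = 0 := by
    rwa [Matrix.conjTranspose_eq_transpose_of_trivial]
  exact Matrix.trace_conjTranspose_mul_self_eq_zero_iff.1 h'

theorem isCompl_hSpace_pSpace (X : stiefel n k) :
    IsCompl (hSpace (X : Matrix (Fin n) (Fin k) ℝ)) (pSpace X) := by
  obtain ⟨X, hX⟩ := X
  change Xᵀ * X = 1 at hX
  have hrefl : (alphaForm n k (-1 / 2)).IsRefl := by
    intro x y h
    rw [← h]
    simp only [alphaForm, LinearMap.mk₂_apply]
    rw [Matrix.trace_mul_comm, Matrix.trace_mul_comm (y.2 : Matrix (Fin k) (Fin k) ℝ)]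
  refine LinearMap.BilinForm.isCompl_orthogonal_of_restrict_nondegenerate hrefl ?_
  suffices hs : LinearMap.SeparatingLeft ((alphaForm n k (-1 / 2)).restrict (hSpace X)) from
    ⟨hs, fun y hy => hs y fun x => hrefl x.1 y.1 (hy x)⟩
  rintro ⟨⟨⟨Ω, hΩ⟩, ⟨Ψ, hΨ⟩⟩, hξ⟩ H
  change Ωᵀ = -Ω at hΩ
  change Ψᵀ = -Ψ at hΨ
  have hξ' : Ω * X = X * Ψ := sub_eq_zero.1 hξ
  have H' : ∀ (A : Matrix (Fin n) (Fin n) ℝ) (B : Matrix (Fin k) (Fin k) ℝ),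
      Aᵀ = -A → Bᵀ = -B → A * X = X * B →
        -(Ω * A).trace + 2 * (Ψ * B).trace = 0 := by
    intro A B hA hB hAB
    have := H ⟨(⟨A, hA⟩, ⟨B, hB⟩), sub_eq_zero.2 hAB⟩
    simp only [alphaForm, LinearMap.BilinForm.restrict_apply, LinearMap.domRestrict_apply,
      LinearMap.mk₂_apply] at this
    linarith
  have h1 : -(Ω * (X * Ψ * Xᵀ)).trace + 2 * (Ψ * Ψ).trace = 0 := by
    refine H' _ _ ?_ hΨ ?_
    · rw [Matrix.transpose_mul, Matrix.transpose_mul, hΨ, Matrix.transpose_transpose]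
      simp [Matrix.mul_assoc]
    · rw [Matrix.mul_assoc, hX, Matrix.mul_one]
  have h2 : (Ω * (X * Ψ * Xᵀ)).trace = (Ψ * Ψ).trace := by
    rw [← Matrix.mul_assoc, ← Matrix.mul_assoc, hξ', Matrix.trace_mul_comm, ← Matrix.mul_assoc,
      ← Matrix.mul_assoc, hX, Matrix.one_mul]
  have hΨ0 : Ψ = 0 := by
    refine trace_transpose_mul_self_eq_zero _ ?_
    rw [hΨ, Matrix.neg_mul, Matrix.trace_neg]
    linarith
  subst hΨ0
  have h3 := H' Ω 0 hΩ hΨ hξ'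
  have hΩ0 : Ω = 0 := by
    refine trace_transpose_mul_self_eq_zero _ ?_
    rw [hΩ, Matrix.neg_mul, Matrix.trace_neg]
    simpa using h3
  subst hΩ0
  rfl

/-- The orthogonal projection `pr_𝔭 : 𝔤 → 𝔭` (as an endomorphism of `𝔤`). -/
def prP (X : stiefel n k) : LieG n k →ₗ[ℝ] LieG n k :=
  (pSpace (X : Matrix (Fin n) (Fin k) ℝ)).projection (hSpace X) (isCompl_hSpace_pSpace X).symm

/-- The orthogonal projection `pr_𝔥 : 𝔤 → 𝔥` (as an endomorphism of `𝔤`). -/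
def prH (X : stiefel n k) : LieG n k →ₗ[ℝ] LieG n k :=
  (hSpace (X : Matrix (Fin n) (Fin k) ℝ)).projection (pSpace X) (isCompl_hSpace_pSpace X)

theorem isCompl_tangentSpace_normalSpace (M : Set (Matrix (Fin n) (Fin k) ℝ))
    (X : Matrix (Fin n) (Fin k) ℝ) :
    IsCompl (tangentSpace M X) (normalSpace (euclideanMetric n k) M X) := by
  have hrefl : (euclideanMetric n k).IsRefl := by
    intro x y h
    rw [← h]
    simp only [euclideanMetric, LinearMap.mk₂_apply]
    rw [← Matrix.trace_transpose, Matrix.transpose_mul, Matrix.transpose_transpose]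
  refine LinearMap.BilinForm.isCompl_orthogonal_of_restrict_nondegenerate hrefl ?_
  suffices hs : LinearMap.SeparatingLeft ((euclideanMetric n k).restrict (tangentSpace M X)) from
    ⟨hs, fun y hy => hs y fun x => hrefl x.1 y.1 (hy x)⟩
  intro x hx
  have h : 2 * ((x : Matrix (Fin n) (Fin k) ℝ)ᵀ * (x : Matrix (Fin n) (Fin k) ℝ)).trace = 0 := hx x
  exact Subtype.ext (trace_transpose_mul_self_eq_zero _ (by linarith))

/-- The orthogonal projection `P_X^⊥` of the real `n × k` matrices onto the normal space
`N_X St(n,k)`. -/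
def normalProj (X : Matrix (Fin n) (Fin k) ℝ) :
    Matrix (Fin n) (Fin k) ℝ →ₗ[ℝ] Matrix (Fin n) (Fin k) ℝ :=
  (normalSpace (euclideanMetric n k) (stiefel n k) X).projection (tangentSpace (stiefel n k) X)
    (isCompl_tangentSpace_normalSpace (stiefel n k) X).symm

/-! ### The ingredients of the rolling along `t ↦ e^{tξ₁} X e^{-tξ₂}` -/

/-- The endomorphism `ad_{ξ_𝔥} + ½ pr_𝔭 ∘ ad_{ξ_𝔭}` of `𝔤` (which maps `𝔭` to `𝔭`). -/
def generator (X : stiefel n k) (ξ : LieG n k) : LieG n k →ₗ[ℝ] LieG n k :=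
  ad (prH X ξ) + (1 / 2 : ℝ) • (prP X ∘ₗ ad (prP X ξ))

/-- `α(t) = ∫₀ᵗ exp(s (ad_{ξ_𝔥} + ½ pr_𝔭 ∘ ad_{ξ_𝔭})) ξ_𝔭 ds`. -/
def alpha (X : stiefel n k) (ξ : LieG n k) (t : ℝ) : LieG n k :=
  ∫ s in (0 : ℝ)..t, opExp (s • generator X ξ) (prP X ξ)

/-- `q(t) = exp(tξ) exp(-tξ_𝔥)`. -/
def q (X : stiefel n k) (ξ : LieG n k) (t : ℝ) : G n k :=
  expG (t • ξ) * expG (-(t • prH X ξ))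

/-- `S(t) = Ad_{exp(tξ_𝔥)} ∘ exp(-t (ad_{ξ_𝔥} + ½ pr_𝔭 ∘ ad_{ξ_𝔭}))`. -/
def S (X : stiefel n k) (ξ : LieG n k) (t : ℝ) : LieG n k →ₗ[ℝ] LieG n k :=
  Ad (expG (t • prH X ξ)) ∘ₗ opExp (-(t • generator X ξ))

/-- `T(t) = Φ_{exp(tξ_𝔥)} ∘ exp(-t P_X^⊥ ∘ f_ξ)`. -/
def T (X : stiefel n k) (ξ : LieG n k) (t : ℝ) :
    Matrix (Fin n) (Fin k) ℝ →ₗ[ℝ] Matrix (Fin n) (Fin k) ℝ :=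
  Phi (expG (t • prH X ξ)) ∘ₗ opExp (-(t • (normalProj (X : Matrix (Fin n) (Fin k) ℝ) ∘ₗ f ξ)))

/-- The map `d_e (ι_X ∘ π) = d_e Φ_X : 𝔤 → T_X St(n,k)`. -/
def dPhiOne (X : stiefel n k) (ζ : LieG n k) : Matrix (Fin n) (Fin k) ℝ :=
  dPhi (X : Matrix (Fin n) (Fin k) ℝ) 1 (dL 1 ζ)

/-- The rolling curve `β(t) = d_e (ι_X ∘ π) (α(t))`. -/
def beta (X : stiefel n k) (ξ : LieG n k) (t : ℝ) : Matrix (Fin n) (Fin k) ℝ :=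
  dPhiOne X (alpha X ξ t)

/-- The development curve `β̂(t) = Φ_{exp(tξ)}(X) = e^{tξ₁} X e^{-tξ₂}`. -/
def betaHat (X : stiefel n k) (ξ : LieG n k) (t : ℝ) : Matrix (Fin n) (Fin k) ℝ :=
  NormedSpace.exp (t • (ξ.1 : Matrix (Fin n) (Fin n) ℝ)) * (X : Matrix (Fin n) (Fin k) ℝ) *
    NormedSpace.exp (-(t • (ξ.2 : Matrix (Fin k) (Fin k) ℝ)))

/-- The tangential part `B(t) = d_{q(t)} (ι_X ∘ π) ∘ d_e L_{q(t)} ∘ S(t) ∘ (d_e (ι_X ∘ π)|_𝔭)⁻¹`.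
The inverse of the bijection `d_e (ι_X ∘ π)|_𝔭` from `𝔭` onto `T_X St(n,k)` is meaningful on
`T_X St(n,k)`. -/
def B (X : stiefel n k) (ξ : LieG n k) (t : ℝ) (v : Matrix (Fin n) (Fin k) ℝ) :
    Matrix (Fin n) (Fin k) ℝ :=
  dPhi (X : Matrix (Fin n) (Fin k) ℝ) (q X ξ t) (dL (q X ξ t) (S X ξ t
    (Function.invFunOn (dPhiOne X) (pSpace (X : Matrix (Fin n) (Fin k) ℝ)) v)))

/-- The normal part `C(t) = Φ_{q(t)} ∘ T(t)`. -/
def C (X : stiefel n k) (ξ : LieG n k) (t : ℝ) (v : Matrix (Fin n) (Fin k) ℝ) :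
    Matrix (Fin n) (Fin k) ℝ :=
  Phi (q X ξ t) (T X ξ t v)

end Stiefel

end

/-!
The idea is to describe both parts of the rolling by the one-parameter group
`Φ_{exp(tξ)} = exp(t f_ξ)` of isometries of the real `n × k` matrices (`Phi_expG`).

Let `E` be `T_X St(n,k)` or `N_X St(n,k)`, and let `A` be the compression of the skew-adjoint map
`f_ξ` to `E`, i.e. `f_ξ` followed by the orthogonal projection onto `E`. Then
`D(t) = exp(t f_ξ) exp(-tA)` maps `E` isometrically onto `Φ_{exp(tξ)} E`, which is the tangent or
normal space of `St(n,k)` at `β̂(t)`. If `Z` is a curve in `E` and `w = exp(-tA) Z`, then the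
derivative of `D Z` is `exp(t f_ξ) (f_ξ w - A w + exp(-tA) Z')`, where `f_ξ w - A w` is orthogonal
to `E`. So the part of this derivative in `exp(t f_ξ) E` vanishes iff `Z' = 0`
(`parallel_transport_iff`), and `Z' = 0` means that `Z` is parallel along a curve in the linear
space `T_X St(n,k)`. This is the condition of no twist.

It remains to see that `B` and `C` are of this form. As `q(t) exp(tξ_𝔥) = exp(tξ)`, this is
immediate for `C` (`C_eq`). For `B` it means that `d_e(ι_X ∘ π)` intertwines
`ad_{ξ_𝔥} + ½ pr_𝔭 ∘ ad_{ξ_𝔭}` on `𝔭` with the tangential compression of `f_ξ`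
(`orbitDeriv_generator`, `B_eq`). Since `f_{ξ_𝔥} X = 0`, this amounts to the normality of
`f_{ξ_𝔭} f_ζ X + f_ζ f_{ξ_𝔭} X` for `ζ` in `𝔭` (`f_f_add_f_f_mem_normalSpace`). The inverse of
`d_e(ι_X ∘ π)` on `𝔭` is the explicit horizontal lift `V ↦ (V Xᵀ - X Vᵀ, Xᵀ V)`, and with it the
sum becomes `X` times a symmetric matrix, which is a normal vector. The intertwining
property also gives `β̇(t) = exp(tA) f_ξ X`, hence the condition of no slip.
-/

namespace Rolling

/-! ### One-parameter groups of endomorphisms -/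

section OpExp

variable {V W : Type*} [NormedAddCommGroup V] [NormedSpace ℝ V] [FiniteDimensional ℝ V]
  [NormedAddCommGroup W] [NormedSpace ℝ W]

theorem opExp_zero : opExp (0 : V →ₗ[ℝ] V) = LinearMap.id := by
  ext x
  simp [opExp, NormedSpace.exp_zero]

theorem opExp_neg_apply_opExp (A : V →ₗ[ℝ] V) (x : V) : opExp (-A) (opExp A x) = x := by
  have : CompleteSpace V := FiniteDimensional.complete ℝ V
  let _ : NormedAlgebra ℚ (V →L[ℝ] V) := NormedAlgebra.restrictScalars ℚ ℝ (V →L[ℝ] V)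
  have h := NormedSpace.exp_add_of_commute
    (Commute.neg_left (Commute.refl (LinearMap.toContinuousLinearMap A)))
  rw [neg_add_cancel, NormedSpace.exp_zero] at h
  have h' := congrArg (fun L : V →L[ℝ] V => L x) h
  simpa [opExp] using h'.symm

theorem opExp_apply_opExp_neg (A : V →ₗ[ℝ] V) (x : V) : opExp A (opExp (-A) x) = x := by
  simpa using opExp_neg_apply_opExp (-A) x

theorem hasSum_opExp_apply (A : V →ₗ[ℝ] V) (x : V) :
    HasSum (fun m : ℕ => ((m.factorial : ℝ)⁻¹) • (A ^ m) x) (opExp A x) := by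
  have : CompleteSpace V := FiniteDimensional.complete ℝ V
  have h := (NormedSpace.exp_series_hasSum_exp' (𝕂 := ℝ) (LinearMap.toContinuousLinearMap A)).mapL
    (ContinuousLinearMap.apply ℝ V x)
  convert! h using 2 with m
  have : ∀ m : ℕ, (A ^ m) x = ((LinearMap.toContinuousLinearMap A) ^ m) x := by
    intro m
    induction m with
    | zero => simp
    | succ m ih => simp [pow_succ', ih]
  simp [this]

/-- A subspace that is invariant under `A` is invariant under `exp A`. -/
theorem opExp_mem {A : V →ₗ[ℝ] V} {E : Submodule ℝ V} (hA : ∀ x ∈ E, A x ∈ E) {x : V}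
    (hx : x ∈ E) : opExp A x ∈ E := by
  have hpow : ∀ m : ℕ, (A ^ m) x ∈ E := by
    intro m
    induction m with
    | zero => simpa
    | succ m ih => rw [pow_succ']; exact hA _ ih
  exact E.closed_of_finiteDimensional.mem_of_tendsto (hasSum_opExp_apply A x)
    (Filter.Eventually.of_forall fun s => E.sum_mem fun m _ => E.smul_mem _ (hpow m))

theorem opExp_apply_of_apply_eq_zero {A : V →ₗ[ℝ] V} {x : V} (h : A x = 0) : opExp A x = x := by
  refine (hasSum_opExp_apply A x).unique ?_
  convert! hasSum_single (f := fun m : ℕ => ((m.factorial : ℝ)⁻¹) • (A ^ m) x) 0 ?_ using 1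
  · simp
  · intro m hm
    obtain ⟨m, rfl⟩ := Nat.exists_eq_succ_of_ne_zero hm
    simp [pow_succ, h]

/-- If `L` intertwines `A` and `A'` on an `A`-invariant subspace, then it intertwines their
exponentials there. -/
theorem map_opExp_apply [FiniteDimensional ℝ W] {A : V →ₗ[ℝ] V} {A' : W →ₗ[ℝ] W}
    {E : Submodule ℝ V} (L : V →ₗ[ℝ] W) (hA : ∀ x ∈ E, A x ∈ E)
    (hL : ∀ x ∈ E, L (A x) = A' (L x)) {x : V} (hx : x ∈ E) :
    L (opExp A x) = opExp A' (L x) := by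
  have hpow : ∀ m : ℕ, (A ^ m) x ∈ E ∧ L ((A ^ m) x) = (A' ^ m) (L x) := by
    intro m
    induction m with
    | zero => simpa
    | succ m ih =>
      rw [pow_succ', pow_succ']
      exact ⟨hA _ ih.1, by simp [hL _ ih.1, ih.2]⟩
  have h := (hasSum_opExp_apply A x).mapL (LinearMap.toContinuousLinearMap L)
  refine h.unique ?_
  convert! hasSum_opExp_apply A' (L x) using 2 with m
  simp [(hpow m).2]

theorem map_opExp_smul_apply [FiniteDimensional ℝ W] {A : V →ₗ[ℝ] V} {A' : W →ₗ[ℝ] W}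
    {E : Submodule ℝ V} (L : V →ₗ[ℝ] W) (hA : ∀ x ∈ E, A x ∈ E)
    (hL : ∀ x ∈ E, L (A x) = A' (L x)) (c : ℝ) {x : V} (hx : x ∈ E) :
    L (opExp (c • A) x) = opExp (c • A') (L x) :=
  map_opExp_apply L (fun y hy => E.smul_mem c (hA y hy))
    (fun y hy => by rw [LinearMap.smul_apply, map_smul, hL y hy, LinearMap.smul_apply]) hx

theorem map_opExp_neg_smul_apply [FiniteDimensional ℝ W] {A : V →ₗ[ℝ] V} {A' : W →ₗ[ℝ] W}
    {E : Submodule ℝ V} (L : V →ₗ[ℝ] W) (hA : ∀ x ∈ E, A x ∈ E)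
    (hL : ∀ x ∈ E, L (A x) = A' (L x)) (c : ℝ) {x : V} (hx : x ∈ E) :
    L (opExp (-(c • A)) x) = opExp (-(c • A')) (L x) := by
  rw [← neg_smul, ← neg_smul, map_opExp_smul_apply L hA hL (-c) hx]

theorem opExp_add_of_commute {A B : Module.End ℝ V} (h : Commute A B) :
    opExp (A + B) = opExp A ∘ₗ opExp B := by
  have : CompleteSpace V := FiniteDimensional.complete ℝ V
  let _ : NormedAlgebra ℚ (V →L[ℝ] V) := NormedAlgebra.restrictScalars ℚ ℝ (V →L[ℝ] V)
  have hc : Commute (LinearMap.toContinuousLinearMap A) (LinearMap.toContinuousLinearMap B) := by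
    ext x
    exact congrArg (fun L : Module.End ℝ V => L x) h.eq
  ext x
  rw [opExp, map_add, NormedSpace.exp_add_of_commute hc]
  rfl

/-- A representation of a finite-dimensional algebra commutes with the exponential maps. -/
theorem opExp_algHom_apply {𝔸 : Type*} [NormedRing 𝔸] [NormedAlgebra ℝ 𝔸] [FiniteDimensional ℝ 𝔸]
    (φ : 𝔸 →ₐ[ℝ] Module.End ℝ V) (a : 𝔸) : opExp (φ a) = φ (NormedSpace.exp a) := by
  have : CompleteSpace 𝔸 := FiniteDimensional.complete ℝ 𝔸
  ext x
  have h := (NormedSpace.exp_series_hasSum_exp' (𝕂 := ℝ) a).mapL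
    (LinearMap.toContinuousLinearMap (φ.toLinearMap.flip x))
  refine (hasSum_opExp_apply (φ a) x).unique ?_
  convert! h using 2 with m
  simp

/-- The matrix exponential depends only on the topology, so that the submultiplicative Frobenius
norm may be used to compute it. -/
theorem opExp_matrix_algHom_apply {m : ℕ} (φ : Matrix (Fin m) (Fin m) ℝ →ₐ[ℝ] Module.End ℝ V)
    (a : Matrix (Fin m) (Fin m) ℝ) : opExp (φ a) = φ (NormedSpace.exp a) :=
  @opExp_algHom_apply V _ _ _ _ Matrix.frobeniusNormedRing Matrix.frobeniusNormedAlgebra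
    (inferInstanceAs (FiniteDimensional ℝ (Matrix (Fin m) (Fin m) ℝ))) φ a

theorem hasDerivAt_opExp_smul (A : V →ₗ[ℝ] V) (t : ℝ) :
    HasDerivAt (fun s : ℝ => LinearMap.toContinuousLinearMap (opExp (s • A)))
      (LinearMap.toContinuousLinearMap (A ∘ₗ opExp (t • A))) t := by
  have : CompleteSpace V := FiniteDimensional.complete ℝ V
  have h := hasDerivAt_exp_smul_const' (𝕂 := ℝ) (LinearMap.toContinuousLinearMap A) t
  convert! h using 1

theorem contDiff_opExp_smul (A : V →ₗ[ℝ] V) :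
    ContDiff ℝ ∞ (fun s : ℝ => LinearMap.toContinuousLinearMap (opExp (s • A))) := by
  have : CompleteSpace V := FiniteDimensional.complete ℝ V
  have h : ContDiff ℝ ∞ (NormedSpace.exp : (V →L[ℝ] V) → (V →L[ℝ] V)) :=
    contDiff_iff_contDiffAt.2 fun x => (NormedSpace.exp_analytic (𝕂 := ℝ) x).contDiffAt
  have h2 : ContDiff ℝ ∞ (fun s : ℝ => s • LinearMap.toContinuousLinearMap A) :=
    contDiff_id.smul contDiff_const
  convert! h.comp h2 using 1

theorem continuous_opExp_smul_apply (A : V →ₗ[ℝ] V) (x : V) :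
    Continuous fun s : ℝ => opExp (s • A) x :=
  ((contDiff_opExp_smul A).clm_apply contDiff_const).continuous

theorem hasDerivAt_map_integral_opExp (A : V →ₗ[ℝ] V) (x : V) (L : V →ₗ[ℝ] W) (t : ℝ) :
    HasDerivAt (fun t : ℝ => L (∫ s in (0 : ℝ)..t, opExp (s • A) x)) (L (opExp (t • A) x)) t := by
  have : CompleteSpace V := FiniteDimensional.complete ℝ V
  exact (LinearMap.toContinuousLinearMap L).hasFDerivAt.comp_hasDerivAt t
    ((continuous_opExp_smul_apply A x).integral_hasStrictDerivAt 0 t).hasDerivAt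

theorem contDiff_map_integral_opExp (A : V →ₗ[ℝ] V) (x : V) (L : V →ₗ[ℝ] W) :
    ContDiff ℝ ∞ (fun t : ℝ => L (∫ s in (0 : ℝ)..t, opExp (s • A) x)) := by
  refine contDiff_infty_iff_deriv.2
    ⟨fun t => (hasDerivAt_map_integral_opExp A x L t).differentiableAt, ?_⟩
  rw [funext fun t => (hasDerivAt_map_integral_opExp A x L t).deriv]
  exact (LinearMap.toContinuousLinearMap L).contDiff.comp
    ((contDiff_opExp_smul A).clm_apply contDiff_const)

theorem integral_opExp_mem {A : V →ₗ[ℝ] V} {E : Submodule ℝ V} (hA : ∀ x ∈ E, A x ∈ E) {x : V}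
    (hx : x ∈ E) (t : ℝ) : ∫ s in (0 : ℝ)..t, opExp (s • A) x ∈ E := by
  have : CompleteSpace V := FiniteDimensional.complete ℝ V
  obtain ⟨P, hP⟩ := E.exists_isCompl
  let L := LinearMap.toContinuousLinearMap (P.projection E hP.symm)
  have hL : ∀ y, L y = 0 ↔ y ∈ E := fun y => Submodule.projection_apply_eq_zero_iff hP.symm
  rw [← hL, ← L.intervalIntegral_comp_comm
    ((continuous_opExp_smul_apply A x).intervalIntegrable (μ := MeasureTheory.volume) 0 t)]
  have h0 : ∀ s : ℝ, L (opExp (s • A) x) = 0 := fun s =>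
    (hL _).2 (opExp_mem (fun y hy => E.smul_mem s (hA y hy)) hx)
  simp only [h0, intervalIntegral.integral_zero]

/-- The exponential of an endomorphism that is skew-adjoint on an invariant subspace is isometric
there. -/
theorem opExp_isometry {b : LinearMap.BilinForm ℝ V} {A : V →ₗ[ℝ] V} {E : Submodule ℝ V}
    (hA : ∀ x ∈ E, A x ∈ E) (hskew : ∀ x ∈ E, ∀ y ∈ E, b (A x) y + b x (A y) = 0)
    {x y : V} (hx : x ∈ E) (hy : y ∈ E) : b (opExp A x) (opExp A y) = b x y := by
  have hmem : ∀ (s : ℝ) {z : V}, z ∈ E → opExp (s • A) z ∈ E := fun s z hz =>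
    opExp_mem (fun w hw => E.smul_mem s (hA w hw)) hz
  have hd : ∀ (z : V) (s : ℝ),
      HasDerivAt (fun s : ℝ => opExp (s • A) z) (A (opExp (s • A) z)) s := fun z s => by
    simpa using (hasDerivAt_opExp_smul A s).clm_apply (hasDerivAt_const s z)
  have hder : ∀ s : ℝ,
      HasDerivAt (fun s : ℝ => b (opExp (s • A) x) (opExp (s • A) y)) 0 s := fun s => by
    have h := (b.toContinuousBilinearMap).hasDerivAt_of_bilinear
      (fun _ => hd x s) (fun _ => hd y s)
    convert! h using 1
    have := hskew _ (hmem s hx) _ (hmem s hy)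
    rw [LinearMap.toContinuousBilinearMap_apply, LinearMap.toContinuousBilinearMap_apply]
    linarith
  -- `s ↦ b (exp(sA) x) (exp(sA) y)` is constant; compare `s = 1` and `s = 0`.
  have hconst := is_const_of_deriv_eq_zero (fun s => (hder s).differentiableAt)
    (fun s => (hder s).deriv) 1 0
  simpa [opExp_zero] using hconst

end OpExp

/-! ### Linear isometries between subspaces -/

section Isometry

variable {W : Type*} [AddCommGroup W] [Module ℝ W]

theorem IsLinearIsometryBetween.of_linearMap {b : LinearMap.BilinForm ℝ W} {E F : Submodule ℝ W}
    (A A' : W →ₗ[ℝ] W) (hA : ∀ x ∈ E, A x ∈ F) (hA' : ∀ y ∈ F, A' y ∈ E)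
    (hl : ∀ x ∈ E, A' (A x) = x) (hr : ∀ y ∈ F, A (A' y) = y)
    (hb : ∀ x ∈ E, ∀ y ∈ E, b (A x) (A y) = b x y) : IsLinearIsometryBetween b b E F A where
  map_add v _ w _ := A.map_add v w
  map_smul c v _ := A.map_smul c v
  bijOn := ⟨hA, fun x hx y hy h => by
    rw [← hl x hx, ← hl y hy]; exact congrArg A' h, fun y hy => ⟨A' y, hA' y hy, hr y hy⟩⟩
  isometry := hb

theorem IsLinearIsometryBetween.comp {b : LinearMap.BilinForm ℝ W} {E F F' : Submodule ℝ W}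
    {A A' : W → W} (hA' : IsLinearIsometryBetween b b F F' A')
    (hA : IsLinearIsometryBetween b b E F A) : IsLinearIsometryBetween b b E F' (A' ∘ A) where
  map_add v hv w hw := by
    simp only [Function.comp_apply]
    rw [hA.map_add v hv w hw, hA'.map_add _ (hA.bijOn.mapsTo hv) _ (hA.bijOn.mapsTo hw)]
  map_smul c v hv := by
    simp only [Function.comp_apply]
    rw [hA.map_smul c v hv, hA'.map_smul c _ (hA.bijOn.mapsTo hv)]
  bijOn := hA'.bijOn.comp hA.bijOn
  isometry v hv w hw := by
    simp only [Function.comp_apply]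
    rw [hA'.isometry _ (hA.bijOn.mapsTo hv) _ (hA.bijOn.mapsTo hw), hA.isometry v hv w hw]

theorem IsLinearIsometryBetween.congr {b : LinearMap.BilinForm ℝ W} {E F : Submodule ℝ W}
    {A A' : W → W} (hA : IsLinearIsometryBetween b b E F A) (h : ∀ v ∈ E, A' v = A v) :
    IsLinearIsometryBetween b b E F A' where
  map_add v hv w hw := by
    rw [h _ (E.add_mem hv hw), h v hv, h w hw, hA.map_add v hv w hw]
  map_smul c v hv := by rw [h _ (E.smul_mem c hv), h v hv, hA.map_smul c v hv]
  bijOn := hA.bijOn.congr fun v hv => (h v hv).symm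
  isometry v hv w hw := by rw [h v hv, h w hw, hA.isometry v hv w hw]

/-- The compression of a skew-adjoint endomorphism is skew-adjoint. -/
theorem compression_skew {g : LinearMap.BilinForm ℝ W} (hs : ∀ v w, g v w = g w v)
    {F A : W →ₗ[ℝ] W} (hF : ∀ v w, g (F v) w + g v (F w) = 0) {E : Submodule ℝ W}
    (hFA : ∀ x ∈ E, ∀ u ∈ E, g (F x - A x) u = 0) :
    ∀ x ∈ E, ∀ y ∈ E, g (A x) y + g x (A y) = 0 := fun x hx y hy => by
  have h1 := hFA x hx y hy
  have h2 := hFA y hy x hx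
  rw [map_sub, LinearMap.sub_apply] at h1 h2
  have h3 := hF x y
  rw [hs x (F y)] at h3
  rw [hs x (A y)]
  linarith

end Isometry

section OpExp

variable {V : Type*} [NormedAddCommGroup V] [NormedSpace ℝ V] [FiniteDimensional ℝ V]

theorem isLinearIsometryBetween_opExp {b : LinearMap.BilinForm ℝ V} {A : V →ₗ[ℝ] V}
    {E : Submodule ℝ V} (hA : ∀ x ∈ E, A x ∈ E)
    (hskew : ∀ x ∈ E, ∀ y ∈ E, b (A x) y + b x (A y) = 0) :
    IsLinearIsometryBetween b b E E (opExp A) := by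
  refine .of_linearMap (opExp A) (opExp (-A)) (fun x hx => opExp_mem hA hx)
    (fun x hx => opExp_mem (fun y hy => E.neg_mem (hA y hy)) hx)
    (fun x _ => opExp_neg_apply_opExp A x) (fun x _ => opExp_apply_opExp_neg A x)
    (fun x hx y hy => opExp_isometry hA hskew hx hy)

/-- The derivative of a curve in a subspace lies in that subspace. -/
theorem hasDerivWithinAt_mem {E : Submodule ℝ V} {I : Set ℝ} {Z : ℝ → V} {Z' : V} {t : ℝ}
    (hI : UniqueDiffWithinAt ℝ I t) (hd : HasDerivWithinAt Z Z' I t) (hZ : ∀ s ∈ I, Z s ∈ E)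
    (ht : t ∈ I) : Z' ∈ E := by
  have : (nhdsWithin t (I \ {t})).NeBot := by
    have := hI.accPt
    rwa [accPt_principal_iff_nhdsWithin] at this
  refine E.closed_of_finiteDimensional.mem_of_tendsto (hasDerivWithinAt_iff_tendsto_slope.1 hd) ?_
  filter_upwards [self_mem_nhdsWithin] with s hs
  exact E.smul_mem _ (E.sub_mem (hZ s hs.1) (hZ t ht))

theorem isLinearIsometryBetween_opExp_neg_smul {b : LinearMap.BilinForm ℝ V} {A : V →ₗ[ℝ] V}
    {E : Submodule ℝ V} (hA : ∀ x ∈ E, A x ∈ E)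
    (hskew : ∀ x ∈ E, ∀ y ∈ E, b (A x) y + b x (A y) = 0) (t : ℝ) :
    IsLinearIsometryBetween b b E E (opExp (-(t • A))) := by
  refine isLinearIsometryBetween_opExp (fun x hx => E.neg_mem (E.smul_mem t (hA x hx)))
    fun x hx y hy => ?_
  have h := hskew x hx y hy
  simp only [LinearMap.neg_apply, LinearMap.smul_apply, map_neg, map_smul, smul_eq_mul]
  linear_combination (-t) * h

/-! ### Transport along a one-parameter group of isometries -/

theorem contDiffOn_opExp_smul_apply (A : V →ₗ[ℝ] V) {I : Set ℝ} {Z : ℝ → V}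
    (hZ : ContDiffOn ℝ ∞ Z I) : ContDiffOn ℝ ∞ (fun t => opExp (t • A) (Z t)) I :=
  (contDiff_opExp_smul A).contDiffOn.clm_apply hZ

/-- The product rule `(exp(tA) Z)' = exp(tA) (A Z + Z')`. -/
theorem hasDerivWithinAt_opExp_smul_apply (A : V →ₗ[ℝ] V) {I : Set ℝ} {Z : ℝ → V} {Z' : V} {t : ℝ}
    (hZ : HasDerivWithinAt Z Z' I t) :
    HasDerivWithinAt (fun t => opExp (t • A) (Z t)) (opExp (t • A) (A (Z t) + Z')) I t := by
  have hcomm : opExp (t • A) (A (Z t)) = A (opExp (t • A) (Z t)) :=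
    (map_opExp_apply (A := t • A) (A' := t • A) (E := ⊤) A (fun _ _ => trivial)
      (fun _ _ => by simp) trivial).symm
  have h := (hasDerivAt_opExp_smul A t).hasDerivWithinAt.clm_apply hZ
  rw [map_add, hcomm]
  exact h

/-- Let `F` be an endomorphism of `V`, and let `A` be the compression of `F` to a subspace `E` on
which the scalar product `g` is definite. The maps `exp(tF) exp(-tA)` from `E` to `exp(tF) E`
transform constant vector fields with values in `E` into the smooth fields along `exp(tF) E` whose
derivatives are orthogonal to `exp(tF) E`. Indeed, with `w = exp(-tA) Z`, the derivative of
`exp(tF) w` is `exp(tF) (F w - A w + exp(-tA) Z')`, where `F w - A w` is orthogonal to `E`. -/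
theorem parallel_transport_iff {g : LinearMap.BilinForm ℝ V} (hg : ∀ v, g v v = 0 → v = 0)
    {F A : V →ₗ[ℝ] V} (hF : ∀ v w, g (F v) w + g v (F w) = 0) {E : Submodule ℝ V}
    (hA : ∀ x ∈ E, A x ∈ E) (hFA : ∀ x ∈ E, ∀ u ∈ E, g (F x - A x) u = 0)
    {I : Set ℝ} (hI : UniqueDiffOn ℝ I) {Z : ℝ → V} (hZ : ∀ t ∈ I, Z t ∈ E) :
    (ContDiffOn ℝ ∞ (fun t => opExp (t • F) (opExp (-(t • A)) (Z t))) I ∧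
      ∀ t ∈ I, ∀ u ∈ E, g (derivWithin (fun t => opExp (t • F) (opExp (-(t • A)) (Z t))) I t)
        (opExp (t • F) u) = 0) ↔
    (ContDiffOn ℝ ∞ Z I ∧ ∀ t ∈ I, ∀ u ∈ E, g (derivWithin Z I t) u = 0) := by
  have hsmooth : ContDiffOn ℝ ∞ (fun t => opExp (t • F) (opExp (-(t • A)) (Z t))) I ↔
      ContDiffOn ℝ ∞ Z I := by
    constructor
    · intro h
      have h1 := contDiffOn_opExp_smul_apply A (contDiffOn_opExp_smul_apply (-F) h)
      refine h1.congr fun t _ => ?_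
      simp only [smul_neg, opExp_neg_apply_opExp, opExp_apply_opExp_neg]
    · intro h
      have h1 := contDiffOn_opExp_smul_apply F (contDiffOn_opExp_smul_apply (-A) h)
      simpa only [smul_neg] using h1
  rw [hsmooth]
  refine and_congr_right fun hZs => forall₂_congr fun t ht => ?_
  have hZd : HasDerivWithinAt Z (derivWithin Z I t) I t :=
    ((hZs t ht).differentiableWithinAt (by simp)).hasDerivWithinAt
  have hZ'E : derivWithin Z I t ∈ E := hasDerivWithinAt_mem (hI t ht) hZd hZ ht
  set w := opExp (-(t • A)) (Z t) with hw
  have hinv : ∀ x ∈ E, opExp (-(t • A)) x ∈ E := fun x hx =>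
    opExp_mem (fun y hy => E.neg_mem (E.smul_mem t (hA y hy))) hx
  have hd1 := hasDerivWithinAt_opExp_smul_apply F (hasDerivWithinAt_opExp_smul_apply (-A) hZd)
  simp only [smul_neg] at hd1
  have hAw : opExp (-(t • A)) (A (Z t)) = A w :=
    (map_opExp_apply (A := -(t • A)) (A' := -(t • A)) (E := ⊤) A (fun _ _ => trivial)
      (fun _ _ => by simp) trivial).symm
  rw [hd1.derivWithin (hI t ht)]
  have hskew : ∀ x ∈ (⊤ : Submodule ℝ V), ∀ y ∈ (⊤ : Submodule ℝ V),
      g ((t • F) x) y + g x ((t • F) y) = 0 := fun x _ y _ => by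
    have := hF x y
    simp only [LinearMap.smul_apply, map_smul, smul_eq_mul]
    rw [← mul_add, this, mul_zero]
  have hkey : ∀ u ∈ E, g (opExp (t • F) (F w + opExp (-(t • A)) ((-A) (Z t) + derivWithin Z I t)))
      (opExp (t • F) u) = g (opExp (-(t • A)) (derivWithin Z I t)) u := fun u hu => by
    rw [opExp_isometry (E := ⊤) (fun _ _ => trivial) hskew trivial trivial]
    have h := hFA w (hinv _ (hZ t ht)) u hu
    have hsplit : F w + opExp (-(t • A)) ((-A) (Z t) + derivWithin Z I t) =
        (F w - A w) + opExp (-(t • A)) (derivWithin Z I t) := by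
      rw [map_add (opExp (-(t • A))), LinearMap.neg_apply, map_neg, hAw]
      abel
    rw [hsplit, map_add, LinearMap.add_apply, h, zero_add]
  -- `exp(-tA) Z'` lies in `E`, so that it vanishes as soon as it is orthogonal to `E`.
  constructor
  · intro h u _
    have h0 : opExp (-(t • A)) (derivWithin Z I t) = 0 :=
      hg _ ((hkey _ (hinv _ hZ'E)).symm.trans (h _ (hinv _ hZ'E)))
    have h1 := opExp_apply_opExp_neg (t • A) (derivWithin Z I t)
    rw [h0, map_zero] at h1
    rw [← h1]
    simp
  · intro h u hu
    have h0 : derivWithin Z I t = 0 := hg _ (h _ hZ'E)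
    rw [hkey u hu, h0]
    simp

/-- Version of `parallel_transport_iff` for a field `Y` that agrees with `exp(tF) exp(-tA) Z` on `I`
and a family of subspaces `E' t = exp(tF) E`. -/
theorem parallel_transport_iff_of_eqOn {g : LinearMap.BilinForm ℝ V} (hg : ∀ v, g v v = 0 → v = 0)
    {F A : V →ₗ[ℝ] V} (hF : ∀ v w, g (F v) w + g v (F w) = 0) {E : Submodule ℝ V}
    (hA : ∀ x ∈ E, A x ∈ E) (hFA : ∀ x ∈ E, ∀ u ∈ E, g (F x - A x) u = 0)
    {I : Set ℝ} (hI : UniqueDiffOn ℝ I) {Z Y : ℝ → V} (hZ : ∀ t ∈ I, Z t ∈ E)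
    (hY : Set.EqOn Y (fun t => opExp (t • F) (opExp (-(t • A)) (Z t))) I)
    {E' : ℝ → Submodule ℝ V} (hE' : ∀ t u, opExp (t • F) u ∈ E' t ↔ u ∈ E) :
    (ContDiffOn ℝ ∞ Y I ∧ (∀ t ∈ I, Y t ∈ E' t) ∧
      ∀ t ∈ I, ∀ w ∈ E' t, g (derivWithin Y I t) w = 0) ↔
    (ContDiffOn ℝ ∞ Z I ∧ (∀ t ∈ I, Z t ∈ E) ∧
      ∀ t ∈ I, ∀ u ∈ E, g (derivWithin Z I t) u = 0) := by
  have hYE : ∀ t ∈ I, Y t ∈ E' t := fun t ht => by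
    rw [hY ht, hE']
    exact opExp_mem (fun y hy => E.neg_mem (E.smul_mem t (hA y hy))) (hZ t ht)
  have h := parallel_transport_iff hg hF hA hFA hI hZ
  rw [contDiffOn_congr hY]
  simp only [and_iff_right hYE, and_iff_right hZ]
  rw [← h]
  refine and_congr_right fun _ => forall₂_congr fun t ht => ?_
  rw [derivWithin_congr hY (hY ht)]
  constructor
  · intro h' u hu
    exact h' _ ((hE' t u).2 hu)
  · intro h' w hw
    rw [← opExp_apply_opExp_neg (t • F) w] at hw ⊢
    exact h' _ ((hE' t _).1 hw)

end OpExp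

/-! ### Tangent spaces of linear subspaces -/

theorem tangentSpace_submodule {V : Type*} [NormedAddCommGroup V] [NormedSpace ℝ V]
    [FiniteDimensional ℝ V] (E : Submodule ℝ V) {p : V} (hp : p ∈ E) :
    tangentSpace (E : Set V) p = E := by
  refine le_antisymm (Submodule.span_le.2 ?_) fun v hv => Submodule.subset_span ?_
  · rintro v ⟨γ, ε, hε, -, hγ, -, hv⟩
    have h0 : (0 : ℝ) ∈ Set.Ioo (-ε) ε := ⟨by linarith, hε⟩
    exact hasDerivWithinAt_mem (isOpen_Ioo.uniqueDiffWithinAt h0) hv.hasDerivWithinAt hγ h0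
  · refine ⟨fun s => p + s • v, 1, one_pos, ?_, fun s _ => E.add_mem hp (E.smul_mem s hv),
      by simp, ?_⟩
    · exact (contDiff_const.add (contDiff_id.smul contDiff_const)).contDiffOn
    · simpa using ((hasDerivAt_id (0 : ℝ)).smul_const v).const_add p

end Rolling

namespace Stiefel

open Rolling

variable {n k : ℕ}

/-! ### The action of `O(n) × O(k)` and its infinitesimal action -/

theorem f_apply (ξ : LieG n k) (V : Matrix (Fin n) (Fin k) ℝ) :
    f ξ V = (ξ.1 : Matrix (Fin n) (Fin n) ℝ) * V - V * (ξ.2 : Matrix (Fin k) (Fin k) ℝ) := rfl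

theorem Phi_apply (g : G n k) (V : Matrix (Fin n) (Fin k) ℝ) :
    Phi g V = (g.1 : Matrix (Fin n) (Fin n) ℝ) * V * (g.2 : Matrix (Fin k) (Fin k) ℝ)ᵀ := rfl

theorem orthogonal_transpose_mul_self {m : ℕ} (R : Matrix.orthogonalGroup (Fin m) ℝ) :
    (R : Matrix (Fin m) (Fin m) ℝ)ᵀ * R = 1 :=
  (Matrix.mem_orthogonalGroup_iff' (Fin m) ℝ).1 R.2

theorem f_add (ξ η : LieG n k) : f (ξ + η) = f ξ + f η := by
  ext V : 1
  simp only [LinearMap.add_apply, f_apply, Prod.fst_add, Prod.snd_add, Submodule.coe_add,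
    Matrix.add_mul, Matrix.mul_add]
  abel

theorem f_smul (c : ℝ) (ξ : LieG n k) : f (c • ξ) = c • f ξ := by
  ext V : 1
  simp [f_apply, smul_sub]

theorem f_neg (ξ : LieG n k) : f (-ξ) = -f ξ := by
  ext V : 1
  simp only [LinearMap.neg_apply, f_apply, Prod.fst_neg, Prod.snd_neg, Submodule.coe_neg,
    Matrix.neg_mul, Matrix.mul_neg]
  abel

/-- The differential `ζ ↦ f_ζ(X)` of the orbit map of `X` at the identity, as a linear map. -/
def orbitDeriv (X : Matrix (Fin n) (Fin k) ℝ) : LieG n k →ₗ[ℝ] Matrix (Fin n) (Fin k) ℝ where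
  toFun ζ := f ζ X
  map_add' ζ η := by rw [f_add]; rfl
  map_smul' c ζ := by rw [f_smul]; rfl

theorem orbitDeriv_apply (X : Matrix (Fin n) (Fin k) ℝ) (ζ : LieG n k) :
    orbitDeriv X ζ = f ζ X := rfl

theorem Phi_one (V : Matrix (Fin n) (Fin k) ℝ) : Phi (1 : G n k) V = V := by
  simp [Phi_apply]

theorem Phi_mul (g h : G n k) (V : Matrix (Fin n) (Fin k) ℝ) :
    Phi (g * h) V = Phi g (Phi h V) := by
  simp [Phi_apply, Matrix.mul_assoc]

theorem Phi_inv_apply_Phi (g : G n k) (V : Matrix (Fin n) (Fin k) ℝ) : Phi g⁻¹ (Phi g V) = V := by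
  rw [← Phi_mul, inv_mul_cancel, Phi_one]

theorem Phi_apply_Phi_inv (g : G n k) (V : Matrix (Fin n) (Fin k) ℝ) : Phi g (Phi g⁻¹ V) = V := by
  rw [← Phi_mul, mul_inv_cancel, Phi_one]

theorem f_ad (a b : LieG n k) (V : Matrix (Fin n) (Fin k) ℝ) :
    f (ad a b) V = f a (f b V) - f b (f a V) := by
  simp only [f_apply, ad, soAd, LinearMap.prodMap_apply, LinearMap.coe_mk, AddHom.coe_mk,
    Matrix.mul_sub, Matrix.sub_mul, Matrix.mul_assoc]
  abel

theorem f_Ad (g : G n k) (ζ : LieG n k) (V : Matrix (Fin n) (Fin k) ℝ) :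
    f (Ad g ζ) (Phi g V) = Phi g (f ζ V) := by
  have h1 := orthogonal_transpose_mul_self g.1
  have h2 := orthogonal_transpose_mul_self g.2
  have h1' : ∀ M : Matrix (Fin n) (Fin k) ℝ,
      (g.1 : Matrix (Fin n) (Fin n) ℝ)ᵀ * ((g.1 : Matrix (Fin n) (Fin n) ℝ) * M) = M := fun M => by
    rw [← Matrix.mul_assoc, h1, Matrix.one_mul]
  have h2' : ∀ M : Matrix (Fin k) (Fin k) ℝ,
      (g.2 : Matrix (Fin k) (Fin k) ℝ)ᵀ * ((g.2 : Matrix (Fin k) (Fin k) ℝ) * M) = M := fun M => by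
    rw [← Matrix.mul_assoc, h2, Matrix.one_mul]
  simp only [f_apply, Phi_apply, Ad, soAdjoint, LinearMap.prodMap_apply, LinearMap.coe_mk,
    AddHom.coe_mk, Matrix.mul_sub, Matrix.sub_mul, Matrix.mul_assoc, h1', h2']

/-- The representation of the `n × n` matrices by left multiplication. -/
def lmul (n k : ℕ) :
    Matrix (Fin n) (Fin n) ℝ →ₐ[ℝ] Module.End ℝ (Matrix (Fin n) (Fin k) ℝ) :=
  AlgHom.ofLinearMap
    (LinearMap.mk₂ ℝ (fun M V => M * V) Matrix.add_mul Matrix.smul_mul Matrix.mul_add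
      (fun c M V => Matrix.mul_smul M c V))
    (LinearMap.ext Matrix.one_mul)
    (fun M N => LinearMap.ext fun V => Matrix.mul_assoc M N V)

/-- The representation of the `k × k` matrices by right multiplication with the transpose. -/
def rmulTranspose (n k : ℕ) :
    Matrix (Fin k) (Fin k) ℝ →ₐ[ℝ] Module.End ℝ (Matrix (Fin n) (Fin k) ℝ) :=
  AlgHom.ofLinearMap
    (LinearMap.mk₂ ℝ (fun M V => V * Mᵀ) (by intros; simp [Matrix.mul_add]) (by intros; simp)
      (by intros; simp [Matrix.add_mul]) (by intros; simp))
    (LinearMap.ext fun V => by simp)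
    (fun M N => LinearMap.ext fun V => by simp [Matrix.mul_assoc])

theorem lmul_apply (M : Matrix (Fin n) (Fin n) ℝ) (V : Matrix (Fin n) (Fin k) ℝ) :
    lmul n k M V = M * V := rfl

theorem rmulTranspose_apply (M : Matrix (Fin k) (Fin k) ℝ) (V : Matrix (Fin n) (Fin k) ℝ) :
    rmulTranspose n k M V = V * Mᵀ := rfl

/-- `exp f_ξ = Φ_{exp ξ}`: the map `f_ξ` is the sum of the commuting left multiplication by `ξ₁`
and right multiplication by `-ξ₂ = ξ₂ᵀ`. -/
theorem Phi_expG (ξ : LieG n k) : Phi (expG ξ) = opExp (f ξ) := by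
  have hcomm : Commute (lmul n k ξ.1) (rmulTranspose n k ξ.2) :=
    LinearMap.ext fun V => (Matrix.mul_assoc (ξ.1 : Matrix (Fin n) (Fin n) ℝ) V
      (ξ.2 : Matrix (Fin k) (Fin k) ℝ)ᵀ).symm
  have hf : f ξ = lmul n k ξ.1 + rmulTranspose n k ξ.2 := by
    ext1 V
    rw [LinearMap.add_apply, lmul_apply, rmulTranspose_apply, f_apply, so_transpose,
      Matrix.mul_neg, sub_eq_add_neg]
  rw [hf, opExp_add_of_commute hcomm, opExp_matrix_algHom_apply, opExp_matrix_algHom_apply]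
  exact LinearMap.ext fun V => Matrix.mul_assoc
    (NormedSpace.exp (ξ.1 : Matrix (Fin n) (Fin n) ℝ)) V
    (NormedSpace.exp (ξ.2 : Matrix (Fin k) (Fin k) ℝ))ᵀ

theorem Phi_expG_smul (ξ : LieG n k) (t : ℝ) : Phi (expG (t • ξ)) = opExp (t • f ξ) := by
  rw [Phi_expG, f_smul]

theorem betaHat_eq (X : stiefel n k) (ξ : LieG n k) (t : ℝ) :
    betaHat X ξ t = Phi (expG (t • ξ)) (X : Matrix (Fin n) (Fin k) ℝ) := by
  rw [Phi_apply, betaHat]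
  change _ = NormedSpace.exp (t • (ξ.1 : Matrix (Fin n) (Fin n) ℝ)) * _ *
    (NormedSpace.exp (t • (ξ.2 : Matrix (Fin k) (Fin k) ℝ)))ᵀ
  rw [← Matrix.exp_transpose, Matrix.transpose_smul, so_transpose, smul_neg]

theorem dPhi_dL (X : Matrix (Fin n) (Fin k) ℝ) (g : G n k) (ζ : LieG n k) :
    dPhi X g (dL g ζ) = Phi g (f ζ X) := by
  let b : Matrix (Fin n) (Fin n) ℝ →ₗ[ℝ] Matrix (Fin k) (Fin k) ℝ →ₗ[ℝ]
      Matrix (Fin n) (Fin k) ℝ :=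
    LinearMap.mk₂ ℝ (fun A C => A * X * Cᵀ) (by intros; simp [Matrix.add_mul])
      (by intros; simp) (by intros; simp [Matrix.mul_add]) (by intros; simp)
  have h := (b.toContinuousBilinearMap).hasFDerivAt_of_bilinear
    (hasFDerivAt_fst (𝕜 := ℝ) (p := ((g.1 : Matrix (Fin n) (Fin n) ℝ),
      (g.2 : Matrix (Fin k) (Fin k) ℝ))))
    (hasFDerivAt_snd (𝕜 := ℝ) (p := ((g.1 : Matrix (Fin n) (Fin n) ℝ),
      (g.2 : Matrix (Fin k) (Fin k) ℝ))))
  have h' : dPhi X g = _ := h.fderiv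
  rw [h']
  change (g.1 : Matrix (Fin n) (Fin n) ℝ) * X *
      ((g.2 : Matrix (Fin k) (Fin k) ℝ) * (ζ.2 : Matrix (Fin k) (Fin k) ℝ))ᵀ +
    (g.1 : Matrix (Fin n) (Fin n) ℝ) * (ζ.1 : Matrix (Fin n) (Fin n) ℝ) * X *
      (g.2 : Matrix (Fin k) (Fin k) ℝ)ᵀ = _
  rw [Phi_apply, f_apply, Matrix.transpose_mul, so_transpose]
  simp only [Matrix.mul_sub, Matrix.sub_mul, Matrix.mul_assoc, Matrix.neg_mul, Matrix.mul_neg]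
  abel

theorem dPhiOne_eq (X : stiefel n k) : dPhiOne X = orbitDeriv (X : Matrix (Fin n) (Fin k) ℝ) := by
  funext ζ
  rw [dPhiOne, dPhi_dL, Phi_one, orbitDeriv_apply]

/-! ### The Euclidean metric -/

theorem euclideanMetric_apply (V W : Matrix (Fin n) (Fin k) ℝ) :
    euclideanMetric n k V W = 2 * (Vᵀ * W).trace := rfl

theorem euclideanMetric_comm (V W : Matrix (Fin n) (Fin k) ℝ) :
    euclideanMetric n k V W = euclideanMetric n k W V := by
  rw [euclideanMetric_apply, euclideanMetric_apply, ← Matrix.trace_transpose, Matrix.transpose_mul,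
    Matrix.transpose_transpose]

theorem euclideanMetric_definite (V : Matrix (Fin n) (Fin k) ℝ) (h : euclideanMetric n k V V = 0) :
    V = 0 := by
  rw [euclideanMetric_apply] at h
  exact trace_transpose_mul_self_eq_zero V (by linarith)

theorem euclideanMetric_f_skew (ξ : LieG n k) (V W : Matrix (Fin n) (Fin k) ℝ) :
    euclideanMetric n k (f ξ V) W + euclideanMetric n k V (f ξ W) = 0 := by
  simp only [euclideanMetric_apply, f_apply, Matrix.transpose_sub, Matrix.transpose_mul,
    so_transpose, Matrix.sub_mul, Matrix.mul_sub, Matrix.trace_sub, Matrix.mul_neg, Matrix.neg_mul,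
    Matrix.trace_neg]
  rw [Matrix.mul_assoc, Matrix.trace_mul_comm (Vᵀ)  (W * (ξ.2 : Matrix (Fin k) (Fin k) ℝ)),
    Matrix.mul_assoc (ξ.2 : Matrix (Fin k) (Fin k) ℝ),
    Matrix.trace_mul_comm (ξ.2 : Matrix (Fin k) (Fin k) ℝ), Matrix.trace_mul_comm (W * _),
    Matrix.mul_assoc]
  ring

theorem euclideanMetric_Phi (g : G n k) (V W : Matrix (Fin n) (Fin k) ℝ) :
    euclideanMetric n k (Phi g V) (Phi g W) = euclideanMetric n k V W := by
  have h1 := orthogonal_transpose_mul_self g.1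
  have h2 := orthogonal_transpose_mul_self g.2
  simp only [euclideanMetric_apply, Phi_apply, Matrix.transpose_mul, Matrix.transpose_transpose]
  rw [Matrix.trace_mul_comm]
  have : (g.1 : Matrix (Fin n) (Fin n) ℝ) * W * (g.2 : Matrix (Fin k) (Fin k) ℝ)ᵀ *
      ((g.2 : Matrix (Fin k) (Fin k) ℝ) * (Vᵀ * (g.1 : Matrix (Fin n) (Fin n) ℝ)ᵀ)) =
      (g.1 : Matrix (Fin n) (Fin n) ℝ) * (W * (((g.2 : Matrix (Fin k) (Fin k) ℝ)ᵀ *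
        (g.2 : Matrix (Fin k) (Fin k) ℝ)) * (Vᵀ * (g.1 : Matrix (Fin n) (Fin n) ℝ)ᵀ))) := by
    simp only [Matrix.mul_assoc]
  rw [this, h2, Matrix.one_mul, Matrix.trace_mul_comm, ← Matrix.mul_assoc, Matrix.mul_assoc, h1,
    Matrix.mul_one, Matrix.trace_mul_comm]

/-! ### The horizontal lift and the tangent spaces of the Stiefel manifold -/

/-- The horizontal lift `(V Xᵀ - X Vᵀ, Xᵀ V)` of a matrix `V` with `Xᵀ V` skew-symmetric, i.e. of a
tangent vector `V` of the Stiefel manifold at `X`. -/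
def horizontalLift (X V : Matrix (Fin n) (Fin k) ℝ) (hV : Xᵀ * V ∈ so k) : LieG n k :=
  (⟨V * Xᵀ - X * Vᵀ, by
    change (_ : Matrix (Fin n) (Fin n) ℝ)ᵀ = - _
    simp [Matrix.transpose_mul]⟩, ⟨Xᵀ * V, hV⟩)

theorem mem_so {A : Matrix (Fin k) (Fin k) ℝ} : A ∈ so k ↔ Aᵀ = -A := Iff.rfl

theorem transpose_mul_eq_neg {X V : Matrix (Fin n) (Fin k) ℝ} (hV : Xᵀ * V ∈ so k) :
    Vᵀ * X = -(Xᵀ * V) := by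
  have := mem_so.1 hV
  rwa [Matrix.transpose_mul, Matrix.transpose_transpose] at this

theorem f_horizontalLift_apply (X V W : Matrix (Fin n) (Fin k) ℝ) (hV : Xᵀ * V ∈ so k) :
    f (horizontalLift X V hV) W = V * (Xᵀ * W) - X * (Vᵀ * W) - W * (Xᵀ * V) := by
  simp only [f_apply, horizontalLift, Matrix.sub_mul, Matrix.mul_assoc]

theorem f_horizontalLift (X : stiefel n k) (V : Matrix (Fin n) (Fin k) ℝ)
    (hV : (X : Matrix (Fin n) (Fin k) ℝ)ᵀ * V ∈ so k) : f (horizontalLift X V hV) X = V := by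
  have hX : (X : Matrix (Fin n) (Fin k) ℝ)ᵀ * (X : Matrix (Fin n) (Fin k) ℝ) = 1 := X.2
  rw [f_horizontalLift_apply, hX, transpose_mul_eq_neg hV]
  simp

theorem transpose_mul_f_mem_so (X : stiefel n k) (ζ : LieG n k) :
    (X : Matrix (Fin n) (Fin k) ℝ)ᵀ * f ζ X ∈ so k := by
  have hX : (X : Matrix (Fin n) (Fin k) ℝ)ᵀ * (X : Matrix (Fin n) (Fin k) ℝ) = 1 := X.2
  have h : (X : Matrix (Fin n) (Fin k) ℝ)ᵀ * f ζ X =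
      (X : Matrix (Fin n) (Fin k) ℝ)ᵀ * ((ζ.1 : Matrix (Fin n) (Fin n) ℝ) *
        (X : Matrix (Fin n) (Fin k) ℝ)) - (ζ.2 : Matrix (Fin k) (Fin k) ℝ) := by
    rw [f_apply, Matrix.mul_sub, ← Matrix.mul_assoc _ _ (ζ.2 : Matrix (Fin k) (Fin k) ℝ), hX,
      Matrix.one_mul]
  rw [h, mem_so]
  simp only [Matrix.transpose_sub, Matrix.transpose_mul, so_transpose, Matrix.transpose_transpose,
    Matrix.mul_neg, Matrix.neg_mul, Matrix.mul_assoc]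
  abel

theorem Phi_mem_stiefel (g : G n k) {X : Matrix (Fin n) (Fin k) ℝ} (hX : X ∈ stiefel n k) :
    Phi g X ∈ stiefel n k := by
  change (Phi g X)ᵀ * Phi g X = 1
  have h1 := orthogonal_transpose_mul_self g.1
  have h2 := (Matrix.mem_orthogonalGroup_iff (Fin k) ℝ).1 g.2.2
  have hX' : Xᵀ * X = 1 := hX
  have : (Phi g X)ᵀ * Phi g X = (g.2 : Matrix (Fin k) (Fin k) ℝ) * (Xᵀ *
      (((g.1 : Matrix (Fin n) (Fin n) ℝ)ᵀ * (g.1 : Matrix (Fin n) (Fin n) ℝ)) * X)) *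
      (g.2 : Matrix (Fin k) (Fin k) ℝ)ᵀ := by
    simp only [Phi_apply, Matrix.transpose_mul, Matrix.transpose_transpose, Matrix.mul_assoc]
  rw [this, h1, Matrix.one_mul, hX', Matrix.mul_one]
  exact h2

/-- The tangent space of the Stiefel manifold at `X` consists of the matrices `V` with `Xᵀ V`
skew-symmetric: differentiate `γᵀ γ = 1` for one inclusion, and take the orbit of `X` under the
one-parameter group generated by the horizontal lift of `V` for the other one. -/
theorem mem_tangentSpace_stiefel (X : stiefel n k) {V : Matrix (Fin n) (Fin k) ℝ} :
    V ∈ tangentSpace (stiefel n k) (X : Matrix (Fin n) (Fin k) ℝ) ↔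
      (X : Matrix (Fin n) (Fin k) ℝ)ᵀ * V ∈ so k := by
  constructor
  · intro h
    let L : Matrix (Fin n) (Fin k) ℝ →ₗ[ℝ] Matrix (Fin k) (Fin k) ℝ :=
      { toFun := fun V => (X : Matrix (Fin n) (Fin k) ℝ)ᵀ * V
        map_add' := Matrix.mul_add _
        map_smul' := fun c V => Matrix.mul_smul _ c V }
    have hle : tangentSpace (stiefel n k) (X : Matrix (Fin n) (Fin k) ℝ) ≤ (so k).comap L := by
      refine Submodule.span_le.2 ?_
      rintro v ⟨γ, ε, hε, -, hγ, h0, hv⟩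
      let b : Matrix (Fin n) (Fin k) ℝ →ₗ[ℝ] Matrix (Fin n) (Fin k) ℝ →ₗ[ℝ]
          Matrix (Fin k) (Fin k) ℝ :=
        LinearMap.mk₂ ℝ (fun A C => Aᵀ * C) (by intros; simp [Matrix.add_mul])
          (by intros; simp) (by intros; simp [Matrix.mul_add]) (by intros; simp)
      have hd := (b.toContinuousBilinearMap).hasDerivAt_of_bilinear
        (fun _ => hv) (fun _ => hv)
      have hc : HasDerivAt (fun s => b (γ s) (γ s)) 0 0 := by
        refine (hasDerivAt_const (0 : ℝ) (1 : Matrix (Fin k) (Fin k) ℝ)).congr_of_eventuallyEq ?_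
        filter_upwards [Ioo_mem_nhds (neg_lt_zero.2 hε) hε] with s hs
        exact hγ s hs
      have he : (γ 0)ᵀ * v + vᵀ * γ 0 = 0 := hd.unique hc
      rw [h0] at he
      change ((X : Matrix (Fin n) (Fin k) ℝ)ᵀ * v)ᵀ = -((X : Matrix (Fin n) (Fin k) ℝ)ᵀ * v)
      rw [Matrix.transpose_mul, Matrix.transpose_transpose]
      exact eq_neg_of_add_eq_zero_right he
    exact hle h
  · intro hV
    refine Submodule.subset_span ⟨fun s => opExp (s • f (horizontalLift X V hV)) X, 1, one_pos,
      ?_, fun s _ => ?_, by simp [opExp_zero], ?_⟩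
    · exact contDiffOn_opExp_smul_apply _ contDiffOn_const
    · have h := Phi_mem_stiefel (expG (s • horizontalLift X V hV)) X.2
      rwa [Phi_expG_smul] at h
    · have h := hasDerivWithinAt_opExp_smul_apply (f (horizontalLift X V hV))
        (hasDerivWithinAt_const (0 : ℝ) Set.univ (X : Matrix (Fin n) (Fin k) ℝ))
      simpa [opExp_zero, f_horizontalLift, hasDerivWithinAt_univ] using h

theorem f_mem_tangentSpace (X : stiefel n k) (ζ : LieG n k) :
    f ζ X ∈ tangentSpace (stiefel n k) (X : Matrix (Fin n) (Fin k) ℝ) :=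
  (mem_tangentSpace_stiefel X).2 (transpose_mul_f_mem_so X ζ)

/-- `Φ_g` maps the tangent space at `X` into the tangent space at `Φ_g(X)`. -/
theorem Phi_mem_tangentSpace (g : G n k) (X : stiefel n k) {V : Matrix (Fin n) (Fin k) ℝ}
    (hV : V ∈ tangentSpace (stiefel n k) (X : Matrix (Fin n) (Fin k) ℝ)) :
    Phi g V ∈ tangentSpace (stiefel n k) (Phi g (X : Matrix (Fin n) (Fin k) ℝ)) := by
  rw [← f_horizontalLift X V ((mem_tangentSpace_stiefel X).1 hV), ← f_Ad]
  exact f_mem_tangentSpace ⟨_, Phi_mem_stiefel g X.2⟩ _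

theorem Phi_mem_tangentSpace_iff (g : G n k) (X : stiefel n k) {V : Matrix (Fin n) (Fin k) ℝ} :
    Phi g V ∈ tangentSpace (stiefel n k) (Phi g (X : Matrix (Fin n) (Fin k) ℝ)) ↔
      V ∈ tangentSpace (stiefel n k) (X : Matrix (Fin n) (Fin k) ℝ) := by
  refine ⟨fun h => ?_, Phi_mem_tangentSpace g X⟩
  have := Phi_mem_tangentSpace g⁻¹ ⟨_, Phi_mem_stiefel g X.2⟩ h
  rwa [Phi_inv_apply_Phi, Phi_inv_apply_Phi] at this

theorem mem_normalSpace {M : Set (Matrix (Fin n) (Fin k) ℝ)} {X V : Matrix (Fin n) (Fin k) ℝ} :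
    V ∈ normalSpace (euclideanMetric n k) M X ↔
      ∀ u ∈ tangentSpace M X, euclideanMetric n k u V = 0 := Iff.rfl

theorem Phi_mem_normalSpace_iff (g : G n k) (X : stiefel n k) {V : Matrix (Fin n) (Fin k) ℝ} :
    Phi g V ∈ normalSpace (euclideanMetric n k) (stiefel n k)
        (Phi g (X : Matrix (Fin n) (Fin k) ℝ)) ↔
      V ∈ normalSpace (euclideanMetric n k) (stiefel n k) (X : Matrix (Fin n) (Fin k) ℝ) := by
  simp only [mem_normalSpace]
  constructor
  · intro h u hu
    rw [← euclideanMetric_Phi g]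
    exact h _ (Phi_mem_tangentSpace g X hu)
  · intro h u hu
    rw [← Phi_apply_Phi_inv g u] at hu ⊢
    rw [euclideanMetric_Phi]
    exact h _ ((Phi_mem_tangentSpace_iff g X).1 hu)

theorem mul_symm_mem_normalSpace (X : stiefel n k) {A : Matrix (Fin k) (Fin k) ℝ} (hA : Aᵀ = A) :
    (X : Matrix (Fin n) (Fin k) ℝ) * A ∈
      normalSpace (euclideanMetric n k) (stiefel n k) (X : Matrix (Fin n) (Fin k) ℝ) := by
  intro u hu
  have h := transpose_mul_eq_neg ((mem_tangentSpace_stiefel X).1 hu)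
  change 2 * (uᵀ * ((X : Matrix (Fin n) (Fin k) ℝ) * A)).trace = 0
  have h1 : (uᵀ * ((X : Matrix (Fin n) (Fin k) ℝ) * A)).trace =
      -((X : Matrix (Fin n) (Fin k) ℝ)ᵀ * u * A).trace := by
    rw [← Matrix.mul_assoc, h, Matrix.neg_mul, Matrix.trace_neg]
  have h2 : (uᵀ * ((X : Matrix (Fin n) (Fin k) ℝ) * A)).trace =
      ((X : Matrix (Fin n) (Fin k) ℝ)ᵀ * u * A).trace := by
    rw [← Matrix.trace_transpose, Matrix.transpose_mul, Matrix.transpose_mul, hA,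
      Matrix.transpose_transpose, Matrix.mul_assoc, Matrix.trace_mul_comm]
  linarith

/-! ### The reductive decomposition -/

theorem alphaForm_apply (ζ η : LieG n k) : alphaForm n k (-1 / 2) ζ η =
    -((ζ.1 : Matrix (Fin n) (Fin n) ℝ) * (η.1 : Matrix (Fin n) (Fin n) ℝ)).trace +
      2 * ((ζ.2 : Matrix (Fin k) (Fin k) ℝ) * (η.2 : Matrix (Fin k) (Fin k) ℝ)).trace := by
  simp only [alphaForm, LinearMap.mk₂_apply]
  ring

theorem alphaForm_comm (ζ η : LieG n k) :
    alphaForm n k (-1 / 2) ζ η = alphaForm n k (-1 / 2) η ζ := by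
  rw [alphaForm_apply, alphaForm_apply, Matrix.trace_mul_comm,
    Matrix.trace_mul_comm (ζ.2 : Matrix (Fin k) (Fin k) ℝ)]

theorem trace_commutator_skew {m : ℕ} (A B C : Matrix (Fin m) (Fin m) ℝ) :
    ((A * B - B * A) * C).trace + (B * (A * C - C * A)).trace = 0 := by
  simp only [Matrix.sub_mul, Matrix.mul_sub, Matrix.trace_sub, Matrix.mul_assoc]
  rw [Matrix.trace_mul_comm A, Matrix.mul_assoc]
  ring

theorem alphaForm_ad_skew (a x y : LieG n k) :
    alphaForm n k (-1 / 2) (ad a x) y + alphaForm n k (-1 / 2) x (ad a y) = 0 := by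
  have h1 := trace_commutator_skew (a.1 : Matrix (Fin n) (Fin n) ℝ) x.1 y.1
  have h2 := trace_commutator_skew (a.2 : Matrix (Fin k) (Fin k) ℝ) x.2 y.2
  simp only [alphaForm_apply, ad, soAd, LinearMap.prodMap_apply, LinearMap.coe_mk, AddHom.coe_mk]
  linarith

theorem trace_conj {m : ℕ} (R : Matrix.orthogonalGroup (Fin m) ℝ) (A B : Matrix (Fin m) (Fin m) ℝ) :
    ((R : Matrix (Fin m) (Fin m) ℝ) * A * (R : Matrix (Fin m) (Fin m) ℝ)ᵀ *
      ((R : Matrix (Fin m) (Fin m) ℝ) * B * (R : Matrix (Fin m) (Fin m) ℝ)ᵀ)).trace =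
      (A * B).trace := by
  have h := orthogonal_transpose_mul_self R
  have h' : ∀ M : Matrix (Fin m) (Fin m) ℝ,
      (R : Matrix (Fin m) (Fin m) ℝ)ᵀ * ((R : Matrix (Fin m) (Fin m) ℝ) * M) = M := fun M => by
    rw [← Matrix.mul_assoc, h, Matrix.one_mul]
  simp only [Matrix.mul_assoc, h']
  rw [Matrix.trace_mul_comm]
  simp only [Matrix.mul_assoc, h, Matrix.mul_one]

theorem alphaForm_Ad (g : G n k) (x y : LieG n k) :
    alphaForm n k (-1 / 2) (Ad g x) (Ad g y) = alphaForm n k (-1 / 2) x y := by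
  simp only [alphaForm_apply, Ad, soAdjoint, LinearMap.prodMap_apply, LinearMap.coe_mk,
    AddHom.coe_mk, trace_conj]

theorem Ad_inv_apply_Ad (g : G n k) (x : LieG n k) : Ad g⁻¹ (Ad g x) = x := by
  have h1 := orthogonal_transpose_mul_self g.1
  have h2 := orthogonal_transpose_mul_self g.2
  have h1' : ∀ M : Matrix (Fin n) (Fin n) ℝ,
      (g.1 : Matrix (Fin n) (Fin n) ℝ)ᵀ * ((g.1 : Matrix (Fin n) (Fin n) ℝ) * M) = M := fun M => by
    rw [← Matrix.mul_assoc, h1, Matrix.one_mul]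
  have h2' : ∀ M : Matrix (Fin k) (Fin k) ℝ,
      (g.2 : Matrix (Fin k) (Fin k) ℝ)ᵀ * ((g.2 : Matrix (Fin k) (Fin k) ℝ) * M) = M := fun M => by
    rw [← Matrix.mul_assoc, h2, Matrix.one_mul]
  refine Prod.ext (Subtype.ext ?_) (Subtype.ext ?_)
  · change (g.1 : Matrix (Fin n) (Fin n) ℝ)ᵀ * ((g.1 : Matrix (Fin n) (Fin n) ℝ) * x.1 *
      (g.1 : Matrix (Fin n) (Fin n) ℝ)ᵀ) * (g.1 : Matrix (Fin n) (Fin n) ℝ)ᵀᵀ = x.1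
    simp only [Matrix.transpose_transpose, Matrix.mul_assoc, h1', h1, Matrix.mul_one]
  · change (g.2 : Matrix (Fin k) (Fin k) ℝ)ᵀ * ((g.2 : Matrix (Fin k) (Fin k) ℝ) * x.2 *
      (g.2 : Matrix (Fin k) (Fin k) ℝ)ᵀ) * (g.2 : Matrix (Fin k) (Fin k) ℝ)ᵀᵀ = x.2
    simp only [Matrix.transpose_transpose, Matrix.mul_assoc, h2', h2, Matrix.mul_one]

/-- The scalar product with a horizontal lift of `V` is the Euclidean metric with `V`. Hence
horizontal lifts are orthogonal to `𝔥`, and horizontal lifting is isometric. -/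
theorem alphaForm_horizontalLift (X : stiefel n k) (V : Matrix (Fin n) (Fin k) ℝ)
    (hV : (X : Matrix (Fin n) (Fin k) ℝ)ᵀ * V ∈ so k) (η : LieG n k) :
    alphaForm n k (-1 / 2) (horizontalLift X V hV) η = euclideanMetric n k V (f η X) := by
  obtain ⟨⟨Ω, hΩ⟩, ⟨Ψ, hΨ⟩⟩ := η
  obtain ⟨X, hX⟩ := X
  rw [mem_so] at hΩ
  rw [alphaForm_apply, euclideanMetric_apply, f_apply]
  change -((V * Xᵀ - X * Vᵀ) * Ω).trace + 2 * ((Xᵀ * V) * Ψ).trace =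
    2 * (Vᵀ * (Ω * X - X * Ψ)).trace
  have h1 : (V * Xᵀ * Ω).trace = -(Vᵀ * (Ω * X)).trace := by
    rw [← Matrix.trace_transpose, Matrix.transpose_mul, Matrix.transpose_mul,
      Matrix.transpose_transpose, hΩ, Matrix.neg_mul, Matrix.trace_neg, ← Matrix.mul_assoc,
      Matrix.trace_mul_comm]
  have h2 : (X * Vᵀ * Ω).trace = (Vᵀ * (Ω * X)).trace := by
    rw [Matrix.mul_assoc, Matrix.trace_mul_comm, Matrix.mul_assoc]
  have h3 : (Vᵀ * (X * Ψ)).trace = -((Xᵀ * V) * Ψ).trace := by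
    rw [← Matrix.mul_assoc, transpose_mul_eq_neg hV, Matrix.neg_mul, Matrix.trace_neg]
  rw [Matrix.sub_mul, Matrix.mul_sub, Matrix.trace_sub, Matrix.trace_sub, h1, h2, h3]
  ring

theorem mem_hSpace {X : Matrix (Fin n) (Fin k) ℝ} {ζ : LieG n k} : ζ ∈ hSpace X ↔ f ζ X = 0 :=
  Iff.rfl

theorem mem_pSpace {X : Matrix (Fin n) (Fin k) ℝ} {ζ : LieG n k} :
    ζ ∈ pSpace X ↔ ∀ η ∈ hSpace X, alphaForm n k (-1 / 2) η ζ = 0 := Iff.rfl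

theorem horizontalLift_mem_pSpace (X : stiefel n k) (V : Matrix (Fin n) (Fin k) ℝ)
    (hV : (X : Matrix (Fin n) (Fin k) ℝ)ᵀ * V ∈ so k) :
    horizontalLift X V hV ∈ pSpace (X : Matrix (Fin n) (Fin k) ℝ) := by
  intro η hη
  change alphaForm n k (-1 / 2) η _ = 0
  rw [alphaForm_comm, alphaForm_horizontalLift, mem_hSpace.1 hη, map_zero]

/-- `d_e(ι_X ∘ π)` is injective on `𝔭`, because its kernel is `𝔥`. -/
theorem pSpace_eq_of_f_eq (X : stiefel n k) {ζ η : LieG n k}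
    (hζ : ζ ∈ pSpace (X : Matrix (Fin n) (Fin k) ℝ))
    (hη : η ∈ pSpace (X : Matrix (Fin n) (Fin k) ℝ))
    (h : f ζ (X : Matrix (Fin n) (Fin k) ℝ) = f η X) : ζ = η := by
  have hmem : ζ - η ∈ hSpace (X : Matrix (Fin n) (Fin k) ℝ) := by
    rw [mem_hSpace, ← orbitDeriv_apply, map_sub, orbitDeriv_apply, orbitDeriv_apply, h, sub_self]
  exact sub_eq_zero.1 (Submodule.disjoint_def.1 (isCompl_hSpace_pSpace X).disjoint _ hmem
    (Submodule.sub_mem _ hζ hη))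

theorem horizontalLift_f (X : stiefel n k) {ζ : LieG n k}
    (hζ : ζ ∈ pSpace (X : Matrix (Fin n) (Fin k) ℝ)) :
    horizontalLift X (f ζ X) (transpose_mul_f_mem_so X ζ) = ζ :=
  pSpace_eq_of_f_eq X (horizontalLift_mem_pSpace X _ _) hζ (f_horizontalLift X _ _)

theorem bijOn_orbitDeriv (X : stiefel n k) :
    Set.BijOn (orbitDeriv (X : Matrix (Fin n) (Fin k) ℝ))
      (pSpace (X : Matrix (Fin n) (Fin k) ℝ))
      (tangentSpace (stiefel n k) (X : Matrix (Fin n) (Fin k) ℝ)) :=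
  ⟨fun ζ _ => f_mem_tangentSpace X ζ, fun _ hζ _ hη h => pSpace_eq_of_f_eq X hζ hη h,
    fun V hV => ⟨_, horizontalLift_mem_pSpace X V ((mem_tangentSpace_stiefel X).1 hV),
      f_horizontalLift X V _⟩⟩

/-- For horizontal `ζ` and `η`, the matrix `f_ζ f_η X + f_η f_ζ X` is normal at `X`: it is the
product of `X` with a symmetric matrix. -/
theorem f_f_add_f_f_mem_normalSpace (X : stiefel n k) {ζ η : LieG n k}
    (hζ : ζ ∈ pSpace (X : Matrix (Fin n) (Fin k) ℝ))
    (hη : η ∈ pSpace (X : Matrix (Fin n) (Fin k) ℝ)) :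
    f ζ (f η (X : Matrix (Fin n) (Fin k) ℝ)) + f η (f ζ X) ∈
      normalSpace (euclideanMetric n k) (stiefel n k) (X : Matrix (Fin n) (Fin k) ℝ) := by
  have h1 := f_horizontalLift_apply (X : Matrix (Fin n) (Fin k) ℝ) (f ζ X) (f η X)
    (transpose_mul_f_mem_so X ζ)
  have h2 := f_horizontalLift_apply (X : Matrix (Fin n) (Fin k) ℝ) (f η X) (f ζ X)
    (transpose_mul_f_mem_so X η)
  rw [horizontalLift_f X hζ] at h1
  rw [horizontalLift_f X hη] at h2
  have h : f ζ (f η (X : Matrix (Fin n) (Fin k) ℝ)) + f η (f ζ X) =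
      (X : Matrix (Fin n) (Fin k) ℝ) *
        -((f ζ (X : Matrix (Fin n) (Fin k) ℝ))ᵀ * f η X + (f η X.1)ᵀ * f ζ X) := by
    rw [h1, h2, Matrix.mul_neg, Matrix.mul_add]
    abel
  rw [h]
  refine mul_symm_mem_normalSpace X ?_
  rw [Matrix.transpose_neg, Matrix.transpose_add, Matrix.transpose_mul, Matrix.transpose_mul,
    Matrix.transpose_transpose, Matrix.transpose_transpose, add_comm]

theorem prP_mem (X : stiefel n k) (ζ : LieG n k) :
    prP X ζ ∈ pSpace (X : Matrix (Fin n) (Fin k) ℝ) :=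
  Submodule.projection_apply_mem _ ζ

theorem prH_mem (X : stiefel n k) (ζ : LieG n k) :
    prH X ζ ∈ hSpace (X : Matrix (Fin n) (Fin k) ℝ) :=
  Submodule.projection_apply_mem _ ζ

theorem prH_add_prP (X : stiefel n k) (ζ : LieG n k) : prH X ζ + prP X ζ = ζ :=
  Submodule.projection_add_projection_eq_self _ ζ

theorem f_prH (X : stiefel n k) (ζ : LieG n k) :
    f (prH X ζ) (X : Matrix (Fin n) (Fin k) ℝ) = 0 :=
  mem_hSpace.1 (prH_mem X ζ)

theorem f_prP (X : stiefel n k) (ζ : LieG n k) :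
    f (prP X ζ) (X : Matrix (Fin n) (Fin k) ℝ) = f ζ X := by
  conv_rhs => rw [← prH_add_prP X ζ]
  rw [f_add, LinearMap.add_apply, f_prH, zero_add]

/-- `𝔤 = 𝔥 ⊕ 𝔭` is reductive: `[𝔥, 𝔭] ⊆ 𝔭`. -/
theorem ad_mem_pSpace (X : stiefel n k) {η ζ : LieG n k}
    (hη : η ∈ hSpace (X : Matrix (Fin n) (Fin k) ℝ))
    (hζ : ζ ∈ pSpace (X : Matrix (Fin n) (Fin k) ℝ)) :
    ad η ζ ∈ pSpace (X : Matrix (Fin n) (Fin k) ℝ) := by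
  intro μ hμ
  have h1 := alphaForm_ad_skew η μ ζ
  have h2 : ad η μ ∈ hSpace (X : Matrix (Fin n) (Fin k) ℝ) := by
    rw [mem_hSpace, f_ad, mem_hSpace.1 hη, mem_hSpace.1 hμ, map_zero, map_zero, sub_zero]
  rw [mem_pSpace.1 hζ _ h2, zero_add] at h1
  exact h1

theorem Ad_mem_pSpace (X : stiefel n k) {g : G n k}
    (hg : Phi g (X : Matrix (Fin n) (Fin k) ℝ) = X) {ζ : LieG n k}
    (hζ : ζ ∈ pSpace (X : Matrix (Fin n) (Fin k) ℝ)) :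
    Ad g ζ ∈ pSpace (X : Matrix (Fin n) (Fin k) ℝ) := by
  intro μ hμ
  have hg' : Phi g⁻¹ (X : Matrix (Fin n) (Fin k) ℝ) = X := by
    conv_lhs => rw [← hg]
    exact Phi_inv_apply_Phi g _
  have h2 : Ad g⁻¹ μ ∈ hSpace (X : Matrix (Fin n) (Fin k) ℝ) := by
    have h := f_Ad g⁻¹ μ (X : Matrix (Fin n) (Fin k) ℝ)
    rw [hg', mem_hSpace.1 hμ, map_zero] at h
    exact h
  change alphaForm n k (-1 / 2) μ (Ad g ζ) = 0
  rw [← alphaForm_Ad g⁻¹, Ad_inv_apply_Ad]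
  exact mem_pSpace.1 hζ _ h2

theorem isLinearIsometryBetween_Ad (X : stiefel n k) {g : G n k}
    (hg : Phi g (X : Matrix (Fin n) (Fin k) ℝ) = X) :
    IsLinearIsometryBetween (alphaForm n k (-1 / 2)) (alphaForm n k (-1 / 2))
      (pSpace (X : Matrix (Fin n) (Fin k) ℝ)) (pSpace (X : Matrix (Fin n) (Fin k) ℝ)) (Ad g) := by
  have hg' : Phi g⁻¹ (X : Matrix (Fin n) (Fin k) ℝ) = X := by
    conv_lhs => rw [← hg]
    exact Phi_inv_apply_Phi g _
  refine .of_linearMap (Ad g) (Ad g⁻¹) (fun _ => Ad_mem_pSpace X hg) (fun _ => Ad_mem_pSpace X hg')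
    (fun x _ => Ad_inv_apply_Ad g x) (fun y _ => ?_) (fun x _ y _ => alphaForm_Ad g x y)
  simpa using Ad_inv_apply_Ad g⁻¹ y

theorem Phi_expG_prH (X : stiefel n k) (ξ : LieG n k) (t : ℝ) :
    Phi (expG (t • prH X ξ)) (X : Matrix (Fin n) (Fin k) ℝ) = X := by
  rw [Phi_expG_smul]
  exact opExp_apply_of_apply_eq_zero (by rw [LinearMap.smul_apply, f_prH, smul_zero])

/-! ### The generator of the tangential part -/

theorem generator_apply (X : stiefel n k) (ξ ζ : LieG n k) :
    generator X ξ ζ = ad (prH X ξ) ζ + (1 / 2 : ℝ) • prP X (ad (prP X ξ) ζ) := rfl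

theorem generator_mem_pSpace (X : stiefel n k) (ξ : LieG n k) :
    ∀ ζ ∈ pSpace (X : Matrix (Fin n) (Fin k) ℝ),
      generator X ξ ζ ∈ pSpace (X : Matrix (Fin n) (Fin k) ℝ) := fun _ hζ =>
  Submodule.add_mem _ (ad_mem_pSpace X (prH_mem X ξ) hζ) (Submodule.smul_mem _ _ (prP_mem X _))

theorem alphaForm_prP (X : stiefel n k) (ζ : LieG n k) {η : LieG n k}
    (hη : η ∈ pSpace (X : Matrix (Fin n) (Fin k) ℝ)) :
    alphaForm n k (-1 / 2) (prP X ζ) η = alphaForm n k (-1 / 2) ζ η := by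
  conv_rhs => rw [← prH_add_prP X ζ]
  rw [map_add, LinearMap.add_apply, mem_pSpace.1 hη _ (prH_mem X ζ), zero_add]

/-- The generator is skew-adjoint on `𝔭`, because the scalar product is `Ad`-invariant. -/
theorem generator_skew (X : stiefel n k) (ξ : LieG n k) :
    ∀ ζ ∈ pSpace (X : Matrix (Fin n) (Fin k) ℝ), ∀ η ∈ pSpace (X : Matrix (Fin n) (Fin k) ℝ),
      alphaForm n k (-1 / 2) (generator X ξ ζ) η +
        alphaForm n k (-1 / 2) ζ (generator X ξ η) = 0 := by
  intro ζ hζ η hη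
  have h1 := alphaForm_ad_skew (prH X ξ) ζ η
  have h2 := alphaForm_ad_skew (prP X ξ) ζ η
  rw [generator_apply, generator_apply, map_add, map_add, LinearMap.add_apply, map_smul, map_smul,
    LinearMap.smul_apply, alphaForm_prP X _ hη, alphaForm_comm ζ (prP X _), alphaForm_prP X _ hζ,
    alphaForm_comm _ ζ, smul_eq_mul, smul_eq_mul]
  linarith

/-- The orthogonal projection of the real `n × k` matrices onto the tangent space `T_X St(n,k)`. -/
noncomputable def tangentProj (X : Matrix (Fin n) (Fin k) ℝ) :
    Matrix (Fin n) (Fin k) ℝ →ₗ[ℝ] Matrix (Fin n) (Fin k) ℝ :=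
  (tangentSpace (stiefel n k) X).projection
    (normalSpace (euclideanMetric n k) (stiefel n k) X)
    (isCompl_tangentSpace_normalSpace (stiefel n k) X)

theorem tangentProj_mem (X V : Matrix (Fin n) (Fin k) ℝ) :
    tangentProj X V ∈ tangentSpace (stiefel n k) X :=
  Submodule.projection_apply_mem _ V

theorem normalProj_mem (X V : Matrix (Fin n) (Fin k) ℝ) :
    normalProj X V ∈ normalSpace (euclideanMetric n k) (stiefel n k) X :=
  Submodule.projection_apply_mem _ V

theorem tangentProj_add_normalProj (X V : Matrix (Fin n) (Fin k) ℝ) :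
    tangentProj X V + normalProj X V = V :=
  Submodule.projection_add_projection_eq_self _ V

theorem euclideanMetric_sub_tangentProj (X V : Matrix (Fin n) (Fin k) ℝ) :
    ∀ u ∈ tangentSpace (stiefel n k) X, euclideanMetric n k (V - tangentProj X V) u = 0 := by
  intro u hu
  rw [sub_eq_of_eq_add' (tangentProj_add_normalProj X V).symm, euclideanMetric_comm]
  exact normalProj_mem X V u hu

theorem euclideanMetric_sub_normalProj (X V : Matrix (Fin n) (Fin k) ℝ) :
    ∀ u ∈ normalSpace (euclideanMetric n k) (stiefel n k) X,
      euclideanMetric n k (V - normalProj X V) u = 0 := by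
  intro u hu
  rw [sub_eq_of_eq_add (tangentProj_add_normalProj X V).symm]
  exact hu _ (tangentProj_mem X V)

/-- `d_e(ι_X ∘ π)` intertwines the restriction of the generator to `𝔭` with the tangential
compression of `f_ξ`. With `ξ = ξ_𝔥 + ξ_𝔭` and `f_{ξ_𝔥} X = 0`, the matrices `f_ξ f_ζ X` and
`f_{generator ζ} X` differ by `½ (f_{ξ_𝔭} f_ζ X + f_ζ f_{ξ_𝔭} X)`, which is normal. -/
theorem orbitDeriv_generator (X : stiefel n k) (ξ : LieG n k) :
    ∀ ζ ∈ pSpace (X : Matrix (Fin n) (Fin k) ℝ),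
      orbitDeriv (X : Matrix (Fin n) (Fin k) ℝ) (generator X ξ ζ) =
        (tangentProj (X : Matrix (Fin n) (Fin k) ℝ) ∘ₗ f ξ)
          (orbitDeriv (X : Matrix (Fin n) (Fin k) ℝ) ζ) := by
  intro ζ hζ
  have hN := Submodule.smul_mem _ (1 / 2 : ℝ) (f_f_add_f_f_mem_normalSpace X (prP_mem X ξ) hζ)
  have hT := f_mem_tangentSpace X (generator X ξ ζ)
  have hsum : f ξ (f ζ (X : Matrix (Fin n) (Fin k) ℝ)) = f (generator X ξ ζ) X +
      (1 / 2 : ℝ) • (f (prP X ξ) (f ζ (X : Matrix (Fin n) (Fin k) ℝ)) + f ζ (f (prP X ξ) X)) := by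
    have h : f ξ (f ζ (X : Matrix (Fin n) (Fin k) ℝ)) =
        f (prH X ξ) (f ζ (X : Matrix (Fin n) (Fin k) ℝ)) + f (prP X ξ) (f ζ X) := by
      conv_lhs => rw [← prH_add_prP X ξ, f_add, LinearMap.add_apply]
    rw [h, generator_apply, f_add, f_smul, LinearMap.add_apply, LinearMap.smul_apply, f_prP, f_ad,
      f_ad, f_prH, map_zero, sub_zero]
    module
  rw [orbitDeriv_apply, orbitDeriv_apply, LinearMap.comp_apply, hsum, map_add]
  rw [tangentProj, (Submodule.projection_apply_eq_zero_iff _).2 hN, add_zero]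
  exact (Submodule.projection_apply_left _ ⟨_, hT⟩).symm

/-! ### The rolling -/

/-- Both parts of the rolling contain `Φ_{q(t)} ∘ Φ_{exp(tξ_𝔥)} = Φ_{exp(tξ)}`. -/
theorem Phi_q_Phi_expG (X : stiefel n k) (ξ : LieG n k) (t : ℝ) (V : Matrix (Fin n) (Fin k) ℝ) :
    Phi (q X ξ t) (Phi (expG (t • prH X ξ)) V) = opExp (t • f ξ) V := by
  rw [q, Phi_mul, Phi_expG, Phi_expG, Phi_expG, f_neg, opExp_neg_apply_opExp, f_smul]

theorem C_eq (X : stiefel n k) (ξ : LieG n k) (t : ℝ) (V : Matrix (Fin n) (Fin k) ℝ) :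
    C X ξ t V = opExp (t • f ξ)
      (opExp (-(t • (normalProj (X : Matrix (Fin n) (Fin k) ℝ) ∘ₗ f ξ))) V) := by
  rw [C, T, LinearMap.comp_apply, Phi_q_Phi_expG]

/-- On the tangent space, `B(t)` is `exp(t f_ξ)` after the exponential of `-t` times the tangential
compression of `f_ξ`. This is the counterpart of the definition of `C(t)`. -/
theorem B_eq (X : stiefel n k) (ξ : LieG n k) (t : ℝ) {V : Matrix (Fin n) (Fin k) ℝ}
    (hV : V ∈ tangentSpace (stiefel n k) (X : Matrix (Fin n) (Fin k) ℝ)) :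
    B X ξ t V = opExp (t • f ξ)
      (opExp (-(t • (tangentProj (X : Matrix (Fin n) (Fin k) ℝ) ∘ₗ f ξ))) V) := by
  have hbij := bijOn_orbitDeriv X
  rw [B, dPhiOne_eq]
  set ζ := Function.invFunOn (orbitDeriv (X : Matrix (Fin n) (Fin k) ℝ))
    (pSpace (X : Matrix (Fin n) (Fin k) ℝ)) V
  have hζ : ζ ∈ pSpace (X : Matrix (Fin n) (Fin k) ℝ) :=
    Function.invFunOn_mem (hbij.surjOn hV)
  have hζV : orbitDeriv (X : Matrix (Fin n) (Fin k) ℝ) ζ = V :=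
    Function.invFunOn_eq (hbij.surjOn hV)
  have hA : f (Ad (expG (t • prH X ξ)) (opExp (-(t • generator X ξ)) ζ))
      (X : Matrix (Fin n) (Fin k) ℝ) =
      Phi (expG (t • prH X ξ)) (f (opExp (-(t • generator X ξ)) ζ) X) := by
    rw [← f_Ad, Phi_expG_prH]
  rw [dPhi_dL, S, LinearMap.comp_apply, hA, Phi_q_Phi_expG, ← orbitDeriv_apply]
  rw [map_opExp_neg_smul_apply _ (generator_mem_pSpace X ξ) (orbitDeriv_generator X ξ) t hζ, hζV]

theorem alpha_mem_pSpace (X : stiefel n k) (ξ : LieG n k) (t : ℝ) :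
    alpha X ξ t ∈ pSpace (X : Matrix (Fin n) (Fin k) ℝ) :=
  integral_opExp_mem (generator_mem_pSpace X ξ) (prP_mem X ξ) t

theorem beta_eq (X : stiefel n k) (ξ : LieG n k) : beta X ξ = fun t : ℝ =>
    orbitDeriv (X : Matrix (Fin n) (Fin k) ℝ)
      (∫ s in (0 : ℝ)..t, opExp (s • generator X ξ) (prP X ξ)) := by
  funext t
  rw [beta, dPhiOne_eq, alpha]

/-- `β̇(t)` is the image of `f_ξ X` under the inverse of the second factor of `B(t)` in `B_eq`;
hence `B(t) β̇(t) = exp(t f_ξ) f_ξ X`, the velocity of `β̂`. -/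
theorem hasDerivAt_beta (X : stiefel n k) (ξ : LieG n k) (t : ℝ) :
    HasDerivAt (beta X ξ)
      (opExp (t • (tangentProj (X : Matrix (Fin n) (Fin k) ℝ) ∘ₗ f ξ)) (f ξ X)) t := by
  rw [beta_eq, ← f_prP, ← orbitDeriv_apply,
    ← map_opExp_smul_apply _ (generator_mem_pSpace X ξ) (orbitDeriv_generator X ξ) t (prP_mem X ξ)]
  exact hasDerivAt_map_integral_opExp _ _ _ t

theorem contDiff_beta (X : stiefel n k) (ξ : LieG n k) : ContDiff ℝ ∞ (beta X ξ) := by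
  rw [beta_eq]
  exact contDiff_map_integral_opExp _ _ _

theorem beta_mem_tangentSpace (X : stiefel n k) (ξ : LieG n k) (t : ℝ) :
    beta X ξ t ∈ tangentSpace (stiefel n k) (X : Matrix (Fin n) (Fin k) ℝ) := by
  rw [beta, dPhiOne_eq]
  exact f_mem_tangentSpace X _

theorem betaHat_eq_opExp (X : stiefel n k) (ξ : LieG n k) (t : ℝ) :
    betaHat X ξ t = opExp (t • f ξ) (X : Matrix (Fin n) (Fin k) ℝ) := by
  rw [betaHat_eq, Phi_expG_smul]

/-- `S(t)` is composed of `Ad_{exp(tξ_𝔥)}`, which is isometric on `𝔭` because `exp(tξ_𝔥)` fixes `X`,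
and of the exponential of a skew-adjoint endomorphism of `𝔭`. -/
theorem isLinearIsometryBetween_S (X : stiefel n k) (ξ : LieG n k) (t : ℝ) :
    IsLinearIsometryBetween (alphaForm n k (-1 / 2)) (alphaForm n k (-1 / 2))
      (pSpace (X : Matrix (Fin n) (Fin k) ℝ)) (pSpace (X : Matrix (Fin n) (Fin k) ℝ))
      (S X ξ t) := by
  exact (isLinearIsometryBetween_Ad X (Phi_expG_prH X ξ t)).comp
    (isLinearIsometryBetween_opExp_neg_smul (generator_mem_pSpace X ξ) (generator_skew X ξ) t)

/-- For the compression `A` of `f_ξ` to a subspace `E`, the maps `exp(-tA)` are isometries of `E`.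
-/
theorem isLinearIsometryBetween_opExp_compression {ξ : LieG n k}
    {E : Submodule ℝ (Matrix (Fin n) (Fin k) ℝ)}
    {A : Matrix (Fin n) (Fin k) ℝ →ₗ[ℝ] Matrix (Fin n) (Fin k) ℝ} (hA : ∀ x ∈ E, A x ∈ E)
    (hfA : ∀ x ∈ E, ∀ u ∈ E, euclideanMetric n k (f ξ x - A x) u = 0) (t : ℝ) :
    IsLinearIsometryBetween (euclideanMetric n k) (euclideanMetric n k) E E
      (opExp (-(t • A))) :=
  isLinearIsometryBetween_opExp_neg_smul hA
    (compression_skew euclideanMetric_comm (euclideanMetric_f_skew ξ) hfA) t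

theorem isLinearIsometryBetween_Phi (g : G n k) {E F : Submodule ℝ (Matrix (Fin n) (Fin k) ℝ)}
    (h : ∀ V, Phi g V ∈ F ↔ V ∈ E) :
    IsLinearIsometryBetween (euclideanMetric n k) (euclideanMetric n k) E F (Phi g) :=
  .of_linearMap (Phi g) (Phi g⁻¹) (fun x hx => (h x).2 hx)
    (fun y hy => (h _).1 (by rwa [Phi_apply_Phi_inv])) (fun x _ => Phi_inv_apply_Phi g x)
    (fun y _ => Phi_apply_Phi_inv g y) (fun x _ y _ => euclideanMetric_Phi g x y)

theorem isLinearIsometryBetween_T (X : stiefel n k) (ξ : LieG n k) (t : ℝ) :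
    IsLinearIsometryBetween (euclideanMetric n k) (euclideanMetric n k)
      (normalSpace (euclideanMetric n k) (stiefel n k) (X : Matrix (Fin n) (Fin k) ℝ))
      (normalSpace (euclideanMetric n k) (stiefel n k) (X : Matrix (Fin n) (Fin k) ℝ))
      (T X ξ t) := by
  refine (isLinearIsometryBetween_Phi _ fun V => ?_).comp
    (isLinearIsometryBetween_opExp_compression
        (A := normalProj (X : Matrix (Fin n) (Fin k) ℝ) ∘ₗ f ξ) (fun x _ => normalProj_mem _ _)
      (fun x _ => euclideanMetric_sub_normalProj _ _) t)
  have h := Phi_mem_normalSpace_iff (expG (t • prH X ξ)) X (V := V)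
  rwa [Phi_expG_prH] at h

theorem isExtrinsicRolling (X : stiefel n k) (ξ : LieG n k) {I : Set ℝ} (hI : I.OrdConnected)
    (hI' : I.Nontrivial) :
    IsExtrinsicRolling (euclideanMetric n k)
      (tangentSpace (stiefel n k) (X : Matrix (Fin n) (Fin k) ℝ) : Set (Matrix (Fin n) (Fin k) ℝ))
      (stiefel n k) I (beta X ξ) (betaHat X ξ) (B X ξ) (C X ξ) := by
  have hU : UniqueDiffOn ℝ I := by
    obtain ⟨a, ha, b, hb, hab⟩ := hI'.exists_lt
    refine uniqueDiffOn_convex hI.convex (Set.Nonempty.mono (interior_mono (hI.out ha hb)) ?_)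
    rw [interior_Icc]
    exact Set.nonempty_Ioo.2 hab
  have hT : ∀ t, tangentSpace (tangentSpace (stiefel n k) (X : Matrix (Fin n) (Fin k) ℝ) :
      Set (Matrix (Fin n) (Fin k) ℝ)) (beta X ξ t) = tangentSpace (stiefel n k) X := fun t =>
    tangentSpace_submodule _ (beta_mem_tangentSpace X ξ t)
  have hN : ∀ t, normalSpace (euclideanMetric n k)
      (tangentSpace (stiefel n k) (X : Matrix (Fin n) (Fin k) ℝ) :
        Set (Matrix (Fin n) (Fin k) ℝ)) (beta X ξ t) =
      normalSpace (euclideanMetric n k) (stiefel n k) X := fun t => by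
    rw [normalSpace, hT, normalSpace]
  have hTt : ∀ (t : ℝ) (V : Matrix (Fin n) (Fin k) ℝ),
      Phi (expG (t • ξ)) V ∈ tangentSpace (stiefel n k) (betaHat X ξ t) ↔
        V ∈ tangentSpace (stiefel n k) (X : Matrix (Fin n) (Fin k) ℝ) := fun t V => by
    rw [betaHat_eq]
    exact Phi_mem_tangentSpace_iff _ X
  have hNt : ∀ (t : ℝ) (V : Matrix (Fin n) (Fin k) ℝ),
      Phi (expG (t • ξ)) V ∈ normalSpace (euclideanMetric n k) (stiefel n k) (betaHat X ξ t) ↔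
        V ∈ normalSpace (euclideanMetric n k) (stiefel n k) (X : Matrix (Fin n) (Fin k) ℝ) :=
    fun t V => by
      rw [betaHat_eq]
      exact Phi_mem_normalSpace_iff _ X
  refine ⟨(contDiff_beta X ξ).contDiffOn, ?_, fun t _ => beta_mem_tangentSpace X ξ t,
    fun t _ => ?_, fun t _ => ?_, fun t _ => ?_, fun t ht => ?_, fun Z hZ => ?_, fun Z hZ => ?_⟩
  · rw [funext (betaHat_eq_opExp X ξ)]
    exact contDiffOn_opExp_smul_apply _ contDiffOn_const
  · rw [betaHat_eq]
    exact Phi_mem_stiefel _ X.2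
  · rw [hT]
    refine ((isLinearIsometryBetween_Phi (expG (t • ξ)) (hTt t)).comp
      (isLinearIsometryBetween_opExp_compression
        (A := tangentProj (X : Matrix (Fin n) (Fin k) ℝ) ∘ₗ f ξ)
        (fun x _ => tangentProj_mem _ _)
        (fun x _ => euclideanMetric_sub_tangentProj _ _) t)).congr fun V hV => ?_
    rw [B_eq X ξ t hV, Function.comp_apply, Phi_expG_smul]
  · rw [hN]
    refine ((isLinearIsometryBetween_Phi (expG (t • ξ)) (hNt t)).comp
      (isLinearIsometryBetween_opExp_compression
        (A := normalProj (X : Matrix (Fin n) (Fin k) ℝ) ∘ₗ f ξ) (fun x _ => normalProj_mem _ _)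
        (fun x _ => euclideanMetric_sub_normalProj _ _) t)).congr fun V hV => ?_
    rw [C_eq X ξ t, Function.comp_apply, Phi_expG_smul]
  · have h := hasDerivWithinAt_opExp_smul_apply (f ξ)
      (hasDerivWithinAt_const t I (X : Matrix (Fin n) (Fin k) ℝ))
    rw [funext (betaHat_eq_opExp X ξ), h.derivWithin (hU t ht),
      (hasDerivAt_beta X ξ t).hasDerivWithinAt.derivWithin (hU t ht), B_eq X ξ t
        (opExp_mem (fun x _ => Submodule.smul_mem _ t (tangentProj_mem _ _))
          (f_mem_tangentSpace X ξ)), opExp_neg_apply_opExp, add_zero]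
  · simp only [hT] at hZ
    simp only [IsParallelAlong, hT]
    refine parallel_transport_iff_of_eqOn euclideanMetric_definite (euclideanMetric_f_skew ξ)
      (A := tangentProj (X : Matrix (Fin n) (Fin k) ℝ) ∘ₗ f ξ) (fun x _ => tangentProj_mem _ _)
      (fun x _ => euclideanMetric_sub_tangentProj _ _) hU hZ (fun t ht => B_eq X ξ t (hZ t ht))
      (E' := fun t => tangentSpace (stiefel n k) (betaHat X ξ t)) fun t u => ?_
    rw [← Phi_expG_smul]
    exact hTt t u
  · simp only [hN] at hZ
    simp only [IsNormalParallelAlong, hN]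
    refine parallel_transport_iff_of_eqOn euclideanMetric_definite (euclideanMetric_f_skew ξ)
      (A := normalProj (X : Matrix (Fin n) (Fin k) ℝ) ∘ₗ f ξ) (fun x _ => normalProj_mem _ _)
      (fun x _ => euclideanMetric_sub_normalProj _ _) hU hZ (fun t _ => C_eq X ξ t (Z t))
      (E' := fun t => normalSpace (euclideanMetric n k) (stiefel n k) (betaHat X ξ t)) fun t u => ?_
    rw [← Phi_expG_smul]
    exact hNt t u

end Stiefel

theorem mainTheorem5 {n k : ℕ} (X : Stiefel.stiefel n k) (ξ : Stiefel.LieG n k)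
    (I : Set ℝ) (hI : I.OrdConnected) (hI' : I.Nontrivial) :
    Set.BijOn (Stiefel.dPhiOne X) (Stiefel.pSpace (X : Matrix (Fin n) (Fin k) ℝ))
        (Rolling.tangentSpace (Stiefel.stiefel n k) X) ∧
    (∀ t : ℝ, Stiefel.betaHat X ξ t =
        Stiefel.Phi (Stiefel.expG (t • ξ)) (X : Matrix (Fin n) (Fin k) ℝ)) ∧
    (∀ t : ℝ, Stiefel.alpha X ξ t ∈ Stiefel.pSpace (X : Matrix (Fin n) (Fin k) ℝ)) ∧
    (∀ t : ℝ, Rolling.IsLinearIsometryBetween (Stiefel.alphaForm n k (-1 / 2))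
        (Stiefel.alphaForm n k (-1 / 2)) (Stiefel.pSpace (X : Matrix (Fin n) (Fin k) ℝ))
        (Stiefel.pSpace (X : Matrix (Fin n) (Fin k) ℝ)) (Stiefel.S X ξ t)) ∧
    (∀ t : ℝ, Rolling.IsLinearIsometryBetween (Stiefel.euclideanMetric n k)
        (Stiefel.euclideanMetric n k)
        (Rolling.normalSpace (Stiefel.euclideanMetric n k) (Stiefel.stiefel n k) X)
        (Rolling.normalSpace (Stiefel.euclideanMetric n k) (Stiefel.stiefel n k) X)
        (Stiefel.T X ξ t)) ∧
    Rolling.IsExtrinsicRolling (Stiefel.euclideanMetric n k)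
      (Rolling.tangentSpace (Stiefel.stiefel n k) (X : Matrix (Fin n) (Fin k) ℝ) :
        Set (Matrix (Fin n) (Fin k) ℝ))
      (Stiefel.stiefel n k) I (Stiefel.beta X ξ) (Stiefel.betaHat X ξ)
      (Stiefel.B X ξ) (Stiefel.C X ξ) := by
  refine ⟨?_, Stiefel.betaHat_eq X ξ, Stiefel.alpha_mem_pSpace X ξ,
    Stiefel.isLinearIsometryBetween_S X ξ, Stiefel.isLinearIsometryBetween_T X ξ,
    Stiefel.isExtrinsicRolling X ξ hI hI'⟩
  rw [Stiefel.dPhiOne_eq]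
  exact Stiefel.bijOn_orbitDeriv X
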